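/- Let $F$ be a field; all Lie algebras considered are finite-dimensional and soluble over $F$. A Lie algebra is \emph{primitive} if it has a maximal subalgebra containing no nonzero ideal; the \emph{socle} $\operatorname{soc}(L)$ is the sum of the minimal ideals of $L$. A \emph{Schunck class} is an isomorphism-closed class $\mathfrak X$ of (finite-dimensional soluble) Lie algebras that is closed under quotients and contains every $L$ all of whose primitive quotients belong to $\mathfrak X$. An \emph{$\mathfrak X$-projector} of $L$ is a subalgebra $U$ such that, for every ideal $K$ of $L$, $(U+K)/K$ is maximal among the subalgebras of $L/K$ that belong to $\mathfrak X$. For Schunck classes $\mathfrak H, \mathfrak K$, we say that $\mathfrak H$ \emph{strongly contains} $\mathfrak K$ if, for every $L$ and every $\mathfrak H$-projector $H$ of $L$, every $\mathfrak K$-projector of $H$ is a $\mathfrak K$-projector of $L$. The \emph{boundary} $b(\mathfrak H)$ is the class of those $L\notin\mathfrak H$ all of whose proper quotients (that is, $L/I$ with $I\neq 0$) belong to $\mathfrak H$. The \emph{avoidance class} $a(\mathfrak K)$ is the class of those primitive $P$ such that $U\cap\operatorname{soc}(P)=0$ for every $\mathfrak K$-projector $U$ of $P$. \textbf{Theorem.}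 Let $\mathfrak K\subseteq\mathfrak H$ be Schunck classes of soluble Lie algebras over $F$. Then $\mathfrak H$ strongly contains $\mathfrak K$ if and only if $b(\mathfrak H)\subseteq a(\mathfrak K)$. -/

import Mathlib

universe u

/-- A class of Lie algebras over `F`, given by its membership predicate. All classes of interest
below consist of finite-dimensional soluble Lie algebras. -/
def LieClass (F : Type u) [Field F] : Type (u + 1) :=
  ∀ (L : Type u) [LieRing L] [LieAlgebra F L], Prop

namespace LieClass

variable {F : Type u} [Field F]

/-- Containment of classes. -/
instance : HasSubset (LieClass F) where
  Subset X Y := ∀ (L : Type u) [LieRing L] [LieAlgebra F L], X L → Y L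

/-- The class of all finite-dimensional soluble Lie algebras over `F`. -/
def soluble (F : Type u) [Field F] : LieClass F :=
  fun L _ _ => Module.Finite F L ∧ LieAlgebra.IsSolvable L

/-- A Lie algebra is primitive if it has a maximal subalgebra containing no nonzero ideal. -/
def IsPrimitive (F : Type u) [Field F] (L : Type u) [LieRing L] [LieAlgebra F L] : Prop :=
  ∃ M : LieSubalgebra F L, IsCoatom M ∧
    ∀ I : LieIdeal F L, LieIdeal.toLieSubalgebra F L I ≤ M → I = ⊥

/-- The class of primitive (finite-dimensional soluble) Lie algebras. -/
def primitive (F : Type u) [Field F] : LieClass F :=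
  fun L _ _ => soluble F L ∧ IsPrimitive F L

/-- The socle: the sum of all minimal ideals. -/
def soc (F : Type u) [Field F] (L : Type u) [LieRing L] [LieAlgebra F L] : LieIdeal F L :=
  sSup {A : LieIdeal F L | IsAtom A}

/-- The canonical projection `L → L ⧸ K` as a homomorphism of Lie algebras. -/
def quotMap {L : Type u} [LieRing L] [LieAlgebra F L] (K : LieIdeal F L) : L →ₗ⁅F⁆ L ⧸ K where
  toLinearMap := (LieSubmodule.Quotient.mk' K : L →ₗ[F] L ⧸ K)
  map_lie' := fun {_ _} => rfl

/-- A Schunck class of soluble Lie algebras: an isomorphism-closed class of finite-dimensional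
soluble Lie algebras which is closed under quotients and which contains every finite-dimensional
soluble Lie algebra all of whose primitive quotients it contains. -/
structure IsSchunck (X : LieClass F) : Prop where
  subset_soluble : X ⊆ soluble F
  iso_closed : ∀ (L L' : Type u) [LieRing L] [LieAlgebra F L] [LieRing L'] [LieAlgebra F L'],
    (L ≃ₗ⁅F⁆ L') → X L → X L'
  quotient_closed : ∀ (L : Type u) [LieRing L] [LieAlgebra F L], X L →
    ∀ I : LieIdeal F L, X (L ⧸ I)
  primitive_closed : ∀ (L : Type u) [LieRing L] [LieAlgebra F L], soluble F L →
    (∀ I : LieIdeal F L, IsPrimitive F (L ⧸ I) → X (L ⧸ I)) → X L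

/-- `U` is `X`-maximal in `L`: it is maximal among the subalgebras of `L` that belong to `X`. -/
def IsMaximalIn (X : LieClass F) {L : Type u} [LieRing L] [LieAlgebra F L]
    (U : LieSubalgebra F L) : Prop :=
  X U ∧ ∀ V : LieSubalgebra F L, U ≤ V → X V → V = U

/-- `U` is an `X`-projector of `L`: for each ideal `K` of `L`, the subalgebra `(U + K) / K` is
`X`-maximal in `L / K`. -/
def IsProjector (X : LieClass F) {L : Type u} [LieRing L] [LieAlgebra F L]
    (U : LieSubalgebra F L) : Prop :=
  ∀ K : LieIdeal F L, X.IsMaximalIn (U.map (quotMap K))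

/-- `H` strongly contains `K`: for every soluble `L` and every `H`-projector `U` of `L`, every
`K`-projector of `U` is a `K`-projector of `L`. -/
def StronglyContains (H K : LieClass F) : Prop :=
  ∀ (L : Type u) [LieRing L] [LieAlgebra F L], soluble F L →
    ∀ U : LieSubalgebra F L, H.IsProjector U →
      ∀ V : LieSubalgebra F U, K.IsProjector V → K.IsProjector (V.map U.incl)

/-- The boundary `b(X)`: the soluble Lie algebras that are not in `X`, but all of whose proper
quotients are in `X`. -/
def boundary (X : LieClass F) : LieClass F :=
  fun L _ _ => soluble F L ∧ ¬ X L ∧ ∀ I : LieIdeal F L, I ≠ ⊥ → X (L ⧸ I)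

/-- The avoidance class `a(X)`: the primitive `P` such that `U ∩ soc P = 0` for all
`X`-projectors `U` of `P`. -/
def avoidance (X : LieClass F) : LieClass F :=
  fun P _ _ => primitive F P ∧ ∀ U : LieSubalgebra F P, X.IsProjector U →
    U ⊓ LieIdeal.toLieSubalgebra F P (soc F P) = ⊥

end LieClass

/-! Two facts about a Schunck class X and an abelian ideal A carry the proof. First, an X-maximal
subalgebra V with V + A = L is already an X-projector (`IsMaximalIn.isHomProjector`). Together with
the lifting principle `IsHomProjector.lift` this builds projectors, and it shows that a projector of
L is a projector of every intermediate subalgebra (`IsHomProjector.of_map`). Second, two projectors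
that both supplement A are conjugate under some 1 + ad a with a in A (`IsHomProjector.conjugate`).

Strong containment implies the boundary condition: an algebra P in b(H) is primitive, P = M + A with
A the socle and M ≅ P/A an H-projector. The image in P/A of a K-projector V of P transports to a
K-projector U of M, which strong containment makes a K-projector of P. As U + A = V + A, the two are
conjugate under A inside this sum, so U ∩ A = 0 gives V ∩ A = 0.

Conversely, let U be an H-projector of L and V a K-projector of U. By induction on dim L the images
of V in proper quotients of L are K-projectors, so only K-maximality of V in L is at stake. If U + N
≠ L for some minimal ideal N, work inside U + N. Otherwise U = L, or U supplements every minimal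
ideal and L lies in b(H). In the latter case a K-maximal R ≥ V is a K-projector of L inside V + N,
and R ∩ soc L = 0 forces R = V. -/

namespace LieClass

variable {F : Type u} [Field F]

/-! ### Quotients, images, and sums of a subalgebra with an ideal -/

section Hom

variable {L : Type u} [LieRing L] [LieAlgebra F L] {M : Type u} [LieRing M] [LieAlgebra F M]
  {Q : Type u} [LieRing Q] [LieAlgebra F Q]

theorem quotMap_surjective (K : LieIdeal F L) : Function.Surjective (quotMap K) :=
  LieSubmodule.Quotient.surjective_mk' K

theorem quotMap_eq_zero {K : LieIdeal F L} {x : L} : quotMap K x = 0 ↔ x ∈ K :=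
  LieSubmodule.Quotient.mk_eq_zero K

theorem quotMap_eq_quotMap {K : LieIdeal F L} {x y : L} :
    quotMap K x = quotMap K y ↔ x - y ∈ K := by
  rw [← quotMap_eq_zero, map_sub, sub_eq_zero]

theorem quotMap_bot_injective : Function.Injective (quotMap (⊥ : LieIdeal F L)) := by
  intro x y h
  rw [quotMap_eq_quotMap, LieSubmodule.mem_bot] at h
  exact sub_eq_zero.mp h

/-- A homomorphism vanishing on an ideal factors through the quotient. -/
def quotLift (K : LieIdeal F L) (f : L →ₗ⁅F⁆ Q) (h : ∀ x ∈ K, f x = 0) : L ⧸ K →ₗ⁅F⁆ Q where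
  toLinearMap := (K : Submodule F L).liftQ (f : L →ₗ[F] Q) (fun x hx => h x hx)
  map_lie' := by
    intro x y
    obtain ⟨x, rfl⟩ := quotMap_surjective K x
    obtain ⟨y, rfl⟩ := quotMap_surjective K y
    exact f.map_lie x y

@[simp]
theorem quotLift_quotMap (K : LieIdeal F L) (f : L →ₗ⁅F⁆ Q) (h : ∀ x ∈ K, f x = 0) (x : L) :
    quotLift K f h (quotMap K x) = f x := rfl

/-- Restriction of the codomain of a homomorphism to a subalgebra containing the range. -/
def codRestrict (f : L →ₗ⁅F⁆ Q) (W : LieSubalgebra F Q) (h : ∀ x, f x ∈ W) : L →ₗ⁅F⁆ W where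
  toLinearMap := (f : L →ₗ[F] Q).codRestrict W.toSubmodule h
  map_lie' := by intro x y; exact Subtype.ext (f.map_lie x y)

theorem incl_codRestrict (f : L →ₗ⁅F⁆ Q) (W : LieSubalgebra F Q) (h : ∀ x, f x ∈ W) :
    W.incl.comp (codRestrict f W h) = f := rfl

/-- The homomorphism from a subalgebra onto its image. -/
def mapRestrict (f : L →ₗ⁅F⁆ Q) (U : LieSubalgebra F L) : U →ₗ⁅F⁆ U.map f :=
  codRestrict (f.comp U.incl) (U.map f) fun x => (LieSubalgebra.mem_map ..).2 ⟨x, x.2, rfl⟩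

theorem mapRestrict_surjective (f : L →ₗ⁅F⁆ Q) (U : LieSubalgebra F L) :
    Function.Surjective (mapRestrict f U) := by
  rintro ⟨y, hy⟩
  obtain ⟨x, hx, rfl⟩ := (LieSubalgebra.mem_map ..).1 hy
  exact ⟨⟨x, hx⟩, rfl⟩

theorem map_map (U : LieSubalgebra F L) (f : L →ₗ⁅F⁆ M) (g : M →ₗ⁅F⁆ Q) :
    (U.map f).map g = U.map (g.comp f) := by
  ext x
  simp only [LieSubalgebra.mem_map, LieHom.comp_apply]
  constructor
  · rintro ⟨_, ⟨y, hy, rfl⟩, rfl⟩; exact ⟨y, hy, rfl⟩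
  · rintro ⟨y, hy, rfl⟩; exact ⟨_, ⟨y, hy, rfl⟩, rfl⟩

theorem mem_map_of_mem (f : L →ₗ⁅F⁆ M) {U : LieSubalgebra F L} {x : L} (hx : x ∈ U) :
    f x ∈ U.map f := (LieSubalgebra.mem_map ..).2 ⟨x, hx, rfl⟩

theorem mem_map_iff_of_injective {f : L →ₗ⁅F⁆ M} (hf : Function.Injective f)
    {U : LieSubalgebra F L} {x : L} : f x ∈ U.map f ↔ x ∈ U := by
  rw [LieSubalgebra.mem_map]
  exact ⟨fun ⟨y, hy, h⟩ => hf h ▸ hy, fun h => ⟨x, h, rfl⟩⟩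

theorem comap_map_of_injective {f : L →ₗ⁅F⁆ M} (hf : Function.Injective f)
    (U : LieSubalgebra F L) : (U.map f).comap f = U := by
  ext x; exact mem_map_iff_of_injective hf

theorem map_comap_of_le_range {f : L →ₗ⁅F⁆ M} {S : LieSubalgebra F M}
    (h : ∀ y ∈ S, ∃ x, f x = y) : (S.comap f).map f = S := by
  ext y
  rw [LieSubalgebra.mem_map]
  constructor
  · rintro ⟨x, hx, rfl⟩; exact hx
  · intro hy
    obtain ⟨x, rfl⟩ := h y hy
    exact ⟨x, hy, rfl⟩

theorem map_mono (f : L →ₗ⁅F⁆ M) {U V : LieSubalgebra F L} (h : U ≤ V) : U.map f ≤ V.map f := by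
  intro x hx
  obtain ⟨y, hy, rfl⟩ := (LieSubalgebra.mem_map ..).1 hx
  exact mem_map_of_mem f (h hy)

theorem map_incl_comap {U W : LieSubalgebra F L} (h : U ≤ W) : (U.comap W.incl).map W.incl = U :=
  map_comap_of_le_range fun y hy => ⟨⟨y, h hy⟩, rfl⟩

theorem top_map_of_surjective {f : L →ₗ⁅F⁆ M} (hf : Function.Surjective f) :
    (⊤ : LieSubalgebra F L).map f = ⊤ := by
  rw [eq_top_iff]
  intro y _
  obtain ⟨x, rfl⟩ := hf y
  exact mem_map_of_mem f (LieSubalgebra.mem_top x)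

theorem soluble_of_surjective (hL : soluble F L) {f : L →ₗ⁅F⁆ M} (hf : Function.Surjective f) :
    soluble F M := by
  obtain ⟨h1, h2⟩ := hL
  exact ⟨Module.Finite.of_surjective (f : L →ₗ[F] M) hf, hf.lieAlgebra_isSolvable⟩

theorem soluble_of_injective (hL : soluble F M) {f : L →ₗ⁅F⁆ M} (hf : Function.Injective f) :
    soluble F L := by
  obtain ⟨h1, h2⟩ := hL
  exact ⟨Module.Finite.of_injective (f : L →ₗ[F] M) hf, hf.lieAlgebra_isSolvable⟩

theorem soluble_subalgebra (hL : soluble F L) (U : LieSubalgebra F L) : soluble F U :=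
  soluble_of_injective hL (f := U.incl) Subtype.val_injective

theorem soluble_quotient (hL : soluble F L) (K : LieIdeal F L) : soluble F (L ⧸ K) :=
  soluble_of_surjective hL (quotMap_surjective K)

theorem finrank_lt_of_surjective (hL : soluble F L) {f : L →ₗ⁅F⁆ M} (hf : Function.Surjective f)
    (hi : ¬ Function.Injective f) : Module.finrank F M < Module.finrank F L := by
  obtain ⟨h1, h2⟩ := hL
  have h3 := LinearMap.finrank_range_add_finrank_ker (f : L →ₗ[F] M)
  rw [LinearMap.range_eq_top.2 hf, finrank_top] at h3
  have : 0 < Module.finrank F (LinearMap.ker (f : L →ₗ[F] M)) := by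
    rw [Nat.pos_iff_ne_zero]
    intro h
    rw [Submodule.finrank_eq_zero, LinearMap.ker_eq_bot] at h
    exact hi h
  omega

theorem finrank_lt_of_ne_top (hL : soluble F L) {W : LieSubalgebra F L} (hW : W ≠ ⊤) :
    Module.finrank F W < Module.finrank F L := by
  obtain ⟨h1, h2⟩ := hL
  refine Submodule.finrank_lt (s := W.toSubmodule) ?_
  intro h
  exact hW (by ext x; simpa using congrArg (x ∈ ·) h)

theorem exists_atom_le (hL : soluble F L) {I : LieIdeal F L} (hI : I ≠ ⊥) :
    ∃ N : LieIdeal F L, IsAtom N ∧ N ≤ I := by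
  obtain ⟨h1, h2⟩ := hL
  have := LieSubmodule.wellFoundedLT_of_isArtinian F L L
  have : IsAtomic (LieIdeal F L) := isAtomic_of_orderBot_wellFounded_lt wellFounded_lt
  exact (eq_bot_or_exists_atom_le I).resolve_left hI

theorem ker_ne_bot {f : L →ₗ⁅F⁆ M} (hi : ¬ Function.Injective f) : f.ker ≠ ⊥ := by
  rwa [Ne, LieHom.ker_eq_bot]

/-- An ideal is abelian if brackets of its elements vanish. -/
def IsAbelianIdeal (A : LieIdeal F L) : Prop := ∀ x ∈ A, ∀ y ∈ A, ⁅x, y⁆ = 0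

/-- By minimality [N, N] is 0 or N. In the second case N would lie in every term of the derived
series of L. -/
theorem IsAbelianIdeal.of_atom (hL : soluble F L) {N : LieIdeal F L} (hN : IsAtom N) :
    IsAbelianIdeal N := by
  obtain ⟨h1, h2⟩ := hL
  have key : ⁅N, N⁆ = ⊥ := by
    rcases hN.le_iff.1 (LieSubmodule.lie_le_left N N) with h | h
    · exact h
    · exfalso
      obtain ⟨k, hk⟩ := LieAlgebra.IsSolvable.solvable F L
      have h3 : ∀ k, LieAlgebra.derivedSeriesOfIdeal F L k N = N := by
        intro k
        induction k with
        | zero => rfl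
        | succ k ih => rw [LieAlgebra.derivedSeriesOfIdeal_succ, ih, h]
      have h4 := LieAlgebra.derivedSeriesOfIdeal_mono (le_top : N ≤ ⊤) k
      rw [h3, ← LieAlgebra.derivedSeries_def, hk] at h4
      exact hN.1 (le_bot_iff.1 h4)
  intro x hx y hy
  have := LieSubmodule.lie_mem_lie hx hy
  rwa [key, LieSubmodule.mem_bot] at this

/-- The sum of a subalgebra and an ideal. -/
def addIdeal (U : LieSubalgebra F L) (I : LieIdeal F L) : LieSubalgebra F L :=
  (U.map (quotMap I)).comap (quotMap I)

theorem mem_addIdeal {U : LieSubalgebra F L} {I : LieIdeal F L} {x : L} :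
    x ∈ addIdeal U I ↔ ∃ u ∈ U, ∃ a ∈ I, u + a = x := by
  rw [addIdeal, LieSubalgebra.mem_comap, LieSubalgebra.mem_map]
  constructor
  · rintro ⟨u, hu, h⟩
    exact ⟨u, hu, x - u, quotMap_eq_quotMap.1 h.symm, by abel⟩
  · rintro ⟨u, hu, a, ha, rfl⟩
    refine ⟨u, hu, ?_⟩
    rw [map_add, quotMap_eq_zero.2 ha, add_zero]

theorem le_addIdeal (U : LieSubalgebra F L) (I : LieIdeal F L) : U ≤ addIdeal U I :=
  fun x hx => mem_addIdeal.2 ⟨x, hx, 0, I.zero_mem, add_zero x⟩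

theorem mem_addIdeal_right (U : LieSubalgebra F L) {I : LieIdeal F L} {x : L} (hx : x ∈ I) :
    x ∈ addIdeal U I :=
  mem_addIdeal.2 ⟨0, U.zero_mem, x, hx, zero_add x⟩

theorem le_addIdeal_of_map_le {U V : LieSubalgebra F L} {I : LieIdeal F L}
    (h : V.map (quotMap I) ≤ U.map (quotMap I)) : V ≤ addIdeal U I :=
  fun _ hx => h (mem_map_of_mem _ hx)

theorem map_quotMap_addIdeal (U : LieSubalgebra F L) (I : LieIdeal F L) :
    (addIdeal U I).map (quotMap I) = U.map (quotMap I) :=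
  map_comap_of_le_range fun y _ => quotMap_surjective I y

theorem addIdeal_eq_top_of_map_eq_top {U : LieSubalgebra F L} {I : LieIdeal F L}
    (h : U.map (quotMap I) = ⊤) : addIdeal U I = ⊤ := by
  rw [addIdeal, h]; rfl

theorem map_eq_top_of_addIdeal_eq_top {U : LieSubalgebra F L} {I : LieIdeal F L} {f : L →ₗ⁅F⁆ M}
    (hf : Function.Surjective f) (hI : ∀ x ∈ I, f x = 0) (h : addIdeal U I = ⊤) :
    U.map f = ⊤ := by
  rw [eq_top_iff]
  intro y _
  obtain ⟨x, rfl⟩ := hf y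
  obtain ⟨u, hu, a, ha, rfl⟩ := mem_addIdeal.1 (h ▸ LieSubalgebra.mem_top x)
  rw [map_add, hI a ha, add_zero]
  exact mem_map_of_mem f hu

/-- A subalgebra supplementing an abelian ideal meets it in an ideal. -/
def interIdeal (U : LieSubalgebra F L) (A : LieIdeal F L) (hA : IsAbelianIdeal A)
    (h : addIdeal U A = ⊤) : LieIdeal F L where
  toSubmodule := U.toSubmodule ⊓ A.toSubmodule
  lie_mem := by
    rintro x y ⟨hy, hy'⟩
    obtain ⟨u, hu, a, ha, rfl⟩ := mem_addIdeal.1 (h ▸ LieSubalgebra.mem_top x)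
    refine ⟨?_, A.lie_mem hy'⟩
    have : ⁅u + a, y⁆ = ⁅u, y⁆ := by rw [add_lie, hA a ha y hy', add_zero]
    rw [this]
    exact U.lie_mem hu hy

/-- U ∩ N is an ideal because U supplements the abelian ideal N. Minimality leaves 0 or N, and N ≤ U
would give U = U + N = L. -/
theorem disjoint_of_atom {U : LieSubalgebra F L} {N : LieIdeal F L} (hN : IsAtom N)
    (hA : IsAbelianIdeal N) (h : addIdeal U N = ⊤) (hU : U ≠ ⊤) :
    ∀ x ∈ U, x ∈ N → x = 0 := by
  have hle : interIdeal U N hA h ≤ N := fun x hx => hx.2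
  rcases hN.le_iff.1 hle with h0 | h0
  · intro x hx hx'
    rw [← LieSubmodule.mem_bot (R := F) (L := L) (M := L), ← h0]
    exact ⟨hx, hx'⟩
  · exfalso
    apply hU
    rw [eq_top_iff]
    intro x _
    obtain ⟨u, hu, a, ha, rfl⟩ := mem_addIdeal.1 (h ▸ LieSubalgebra.mem_top x)
    rw [← h0] at ha
    exact U.add_mem hu ha.1

end Hom

/-! ### Closure properties of Schunck classes; projectors via surjective homomorphisms -/

section Projector

variable {X : LieClass F}
variable {L : Type u} [LieRing L] [LieAlgebra F L] {M : Type u} [LieRing M] [LieAlgebra F M]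
  {Q : Type u} [LieRing Q] [LieAlgebra F Q]

theorem IsSchunck.of_bijective (hX : X.IsSchunck) (hL : X L) {f : L →ₗ⁅F⁆ M}
    (hf : Function.Bijective f) : X M :=
  hX.iso_closed L M (LieEquiv.ofBijective f hf) hL

theorem IsSchunck.of_surjective (hX : X.IsSchunck) (hL : X L) {f : L →ₗ⁅F⁆ M}
    (hf : Function.Surjective f) : X M := by
  refine hX.of_bijective (hX.quotient_closed L hL f.ker)
    (f := quotLift f.ker f fun x hx => LieHom.mem_ker.1 hx) ⟨?_, ?_⟩
  · intro x y h
    obtain ⟨x, rfl⟩ := quotMap_surjective _ x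
    obtain ⟨y, rfl⟩ := quotMap_surjective _ y
    rw [quotLift_quotMap, quotLift_quotMap] at h
    rw [quotMap_eq_quotMap, LieHom.mem_ker, map_sub, h, sub_self]
  · intro y
    obtain ⟨x, rfl⟩ := hf y
    exact ⟨quotMap _ x, rfl⟩

theorem IsSchunck.map (hX : X.IsSchunck) {U : LieSubalgebra F L} (hU : X U) (f : L →ₗ⁅F⁆ M) :
    X (U.map f) := hX.of_surjective hU (mapRestrict_surjective f U)

theorem IsSchunck.of_map (hX : X.IsSchunck) {U : LieSubalgebra F L} {f : L →ₗ⁅F⁆ M}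
    (hf : ∀ x ∈ U, f x = 0 → x = 0) (hU : X (U.map f)) : X U := by
  have hb : Function.Bijective (mapRestrict f U) := by
    refine ⟨?_, mapRestrict_surjective f U⟩
    rw [injective_iff_map_eq_zero]
    intro x hx
    exact Subtype.ext (hf x x.2 (congrArg Subtype.val hx))
  exact hX.iso_closed _ _ (LieEquiv.ofBijective _ hb).symm hU

theorem IsSchunck.top_iff (hX : X.IsSchunck) : X (⊤ : LieSubalgebra F L) ↔ X L :=
  ⟨fun h => hX.of_surjective h (f := (⊤ : LieSubalgebra F L).incl) fun x => ⟨⟨x, trivial⟩, rfl⟩,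
    fun h => hX.of_surjective h (f := codRestrict LieHom.id ⊤ fun _ => trivial)
      fun x => ⟨x, rfl⟩⟩

theorem IsSchunck.isMaximalIn_top (hX : X.IsSchunck) (hL : X L) :
    X.IsMaximalIn (⊤ : LieSubalgebra F L) :=
  ⟨hX.top_iff.2 hL, fun _ hV _ => top_le_iff.1 hV⟩

theorem IsMaximalIn.eq_top (hX : X.IsSchunck) {U : LieSubalgebra F L} (hU : X.IsMaximalIn U)
    (hL : X L) : U = ⊤ := (hU.2 ⊤ le_top (hX.top_iff.2 hL)).symm

theorem IsMaximalIn.of_map (hX : X.IsSchunck) {U : LieSubalgebra F L} {f : L →ₗ⁅F⁆ M}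
    (hf : Function.Injective f) (hU : X.IsMaximalIn (U.map f)) : X.IsMaximalIn U := by
  have hf0 : ∀ V : LieSubalgebra F L, ∀ x ∈ V, f x = 0 → x = 0 := fun V x _ hx =>
    (injective_iff_map_eq_zero f).1 hf x hx
  refine ⟨hX.of_map (hf0 U) hU.1, fun V hUV hV => ?_⟩
  have := hU.2 (V.map f) (map_mono f hUV) (hX.map hV f)
  rw [← comap_map_of_injective hf V, this, comap_map_of_injective hf]

/-- Maximality inside a subalgebra, expressed in the ambient algebra. -/
theorem IsMaximalIn.eq_of_le_range (hX : X.IsSchunck) {U : LieSubalgebra F L} {f : L →ₗ⁅F⁆ M}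
    (hf : Function.Injective f) (hU : X.IsMaximalIn U) {S : LieSubalgebra F M}
    (hS : ∀ y ∈ S, ∃ x, f x = y) (hUS : U.map f ≤ S) (hXS : X S) : S = U.map f := by
  rw [← map_comap_of_le_range hS] at hXS ⊢
  have : S.comap f = U := by
    refine hU.2 _ (fun x hx => hUS (mem_map_of_mem f hx)) (hX.of_map ?_ hXS)
    exact fun x _ hx => (injective_iff_map_eq_zero f).1 hf x hx
  rw [this]

theorem IsMaximalIn.map (hX : X.IsSchunck) {U : LieSubalgebra F L} {f : L →ₗ⁅F⁆ M}
    (hf : Function.Bijective f) (hU : X.IsMaximalIn U) : X.IsMaximalIn (U.map f) :=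
  ⟨hX.map hU.1 f, fun _ hUV hV => hU.eq_of_le_range hX hf.1 (fun y _ => hf.2 y) hUV hV⟩

/-- `U` is a projector in the sense of homomorphic images: its image under each surjective
homomorphism is `X`-maximal. -/
def IsHomProjector (X : LieClass F) (U : LieSubalgebra F L) : Prop :=
  ∀ (Q : Type u) [LieRing Q] [LieAlgebra F Q] (f : L →ₗ⁅F⁆ Q), Function.Surjective f →
    X.IsMaximalIn (U.map f)

theorem IsHomProjector.map {U : LieSubalgebra F L} (hU : X.IsHomProjector U) {f : L →ₗ⁅F⁆ M}
    (hf : Function.Surjective f) : X.IsHomProjector (U.map f) := by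
  intro Q _ _ g hg
  rw [map_map]
  exact hU Q (g.comp f) (hg.comp hf)

theorem map_id (U : LieSubalgebra F L) : U.map LieHom.id = U := by
  ext x; simp [LieSubalgebra.mem_map]

theorem IsHomProjector.isMaximalIn {U : LieSubalgebra F L} (hU : X.IsHomProjector U) :
    X.IsMaximalIn U := by
  have := hU L LieHom.id Function.surjective_id
  rwa [map_id] at this

/-- The first isomorphism theorem. The homomorphic form passes to images by mere composition, so
quotients of quotients never have to be identified. -/
theorem IsSchunck.isProjector_iff (hX : X.IsSchunck) {U : LieSubalgebra F L} :
    X.IsProjector U ↔ X.IsHomProjector U := by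
  refine ⟨fun hU Q _ _ f hf => ?_, fun hU K => hU _ _ (quotMap_surjective K)⟩
  have hlift : Function.Bijective (quotLift f.ker f fun x hx => LieHom.mem_ker.1 hx) := by
    refine ⟨?_, fun y => ?_⟩
    · intro x y h
      obtain ⟨x, rfl⟩ := quotMap_surjective _ x
      obtain ⟨y, rfl⟩ := quotMap_surjective _ y
      rw [quotLift_quotMap, quotLift_quotMap] at h
      rw [quotMap_eq_quotMap, LieHom.mem_ker, map_sub, h, sub_self]
    · obtain ⟨x, rfl⟩ := hf y
      exact ⟨quotMap _ x, rfl⟩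
  have := (hU f.ker).map hX hlift
  rw [map_map] at this
  exact this

theorem IsHomProjector.of_bijective_map {U : LieSubalgebra F L} {f : L →ₗ⁅F⁆ M}
    (hf : Function.Bijective f) (hU : X.IsHomProjector (U.map f)) : X.IsHomProjector U := by
  let e := (LieEquiv.ofBijective f hf).symm.toLieHom
  have he : ∀ x, e (f x) = x := (LieEquiv.ofBijective f hf).symm_apply_apply
  have := hU.map (f := e) (LieEquiv.ofBijective f hf).symm.surjective
  rw [map_map] at this
  convert this
  ext x
  simp [LieSubalgebra.mem_map, LieHom.comp_apply, he]

/-- A subalgebra that is a projector modulo `N` lifts to a projector of the whole algebra by taking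
one of its own projectors. -/
theorem IsHomProjector.lift (hX : X.IsSchunck) {T : Type u} [LieRing T] [LieAlgebra F T]
    {i : T →ₗ⁅F⁆ L} {N : LieIdeal F L} (hN : ∀ x ∈ N, x ∈ i.range)
    (hT : X.IsHomProjector (i.range.map (quotMap N))) {R : LieSubalgebra F T}
    (hR : X.IsHomProjector R) : X.IsHomProjector (R.map i) := by
  -- `R` covers `T / N`
  have hcov : (R.map i).map (quotMap N) = i.range.map (quotMap N) := by
    let k := codRestrict ((quotMap N).comp i) (i.range.map (quotMap N))
      fun x => mem_map_of_mem _ (i.mem_range_self x)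
    have hk : Function.Surjective k := by
      rintro ⟨y, hy⟩
      obtain ⟨x, hx, rfl⟩ := (LieSubalgebra.mem_map ..).1 hy
      obtain ⟨t, rfl⟩ := hx
      exact ⟨t, rfl⟩
    have h1 := (hR _ k hk).eq_top hX hT.isMaximalIn.1
    have h2 := congrArg (LieSubalgebra.map (i.range.map (quotMap N)).incl) h1
    have hc : (i.range.map (quotMap N)).incl.comp k = (quotMap N).comp i := rfl
    rw [map_map, hc] at h2
    rw [map_map, h2]
    ext y
    simp [LieSubalgebra.mem_map]
  intro Q _ _ f hf
  refine ⟨hX.map (hX.map hR.isMaximalIn.1 i) f, fun S hRS hS => ?_⟩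
  let J : LieIdeal F Q := LieIdeal.map f N
  let b : L ⧸ N →ₗ⁅F⁆ Q ⧸ J := quotLift N ((quotMap J).comp f) fun x hx =>
    quotMap_eq_zero.2 (LieIdeal.mem_map hx)
  have hb : Function.Surjective b := by
    intro y
    obtain ⟨y, rfl⟩ := quotMap_surjective _ y
    obtain ⟨x, rfl⟩ := hf y
    exact ⟨quotMap N x, rfl⟩
  have hmax := hT _ b hb
  have hcomp : b.comp (quotMap N) = (quotMap J).comp f := rfl
  -- Modulo the image J of N, the subalgebra S cannot exceed the image of T. Since T contains N,
  -- this puts S inside f(T), where the projector property of `R` applies.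
  have hSJ : S.map (quotMap J) = (i.range.map (quotMap N)).map b := by
    refine hmax.2 _ ?_ (hX.map hS _)
    rw [← hcov, map_map _ (quotMap N), hcomp, ← map_map]
    exact map_mono _ hRS
  have hrange : ∀ y ∈ S, ∃ x, (i.range.map f).incl x = y := by
    intro y hy
    have h1 : quotMap J y ∈ (i.range.map (quotMap N)).map b := hSJ ▸ mem_map_of_mem _ hy
    rw [map_map, hcomp, LieSubalgebra.mem_map] at h1
    obtain ⟨t, ht, h2⟩ := h1
    have h3 : y - f t ∈ J := quotMap_eq_quotMap.1 h2.symm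
    obtain ⟨n, hn⟩ := LieIdeal.mem_map_of_surjective hf h3
    have h4 : f (t + n) = y := by rw [map_add, hn]; abel
    exact ⟨⟨y, h4 ▸ mem_map_of_mem f (i.range.add_mem ht (hN n n.2))⟩, rfl⟩
  let k : T →ₗ⁅F⁆ i.range.map f := codRestrict (f.comp i) _
    fun x => mem_map_of_mem _ (i.mem_range_self x)
  have hk : Function.Surjective k := by
    rintro ⟨y, hy⟩
    obtain ⟨x, hx, rfl⟩ := (LieSubalgebra.mem_map ..).1 hy
    obtain ⟨t, rfl⟩ := hx
    exact ⟨t, rfl⟩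
  have hkm : (R.map k).map (i.range.map f).incl = (R.map i).map f := by
    rw [map_map, map_map]; rfl
  have := (hR _ k hk).eq_of_le_range hX (f := (i.range.map f).incl) Subtype.val_injective hrange
    (by rwa [hkm]) hS
  rw [this, hkm]

end Projector

end LieClass

/-! ### Primitive algebras, and projectors supplementing an abelian ideal -/

namespace LieClass

variable {F : Type u} [Field F]
variable {X : LieClass F}
variable {L : Type u} [LieRing L] [LieAlgebra F L] {M : Type u} [LieRing M] [LieAlgebra F M]

theorem IsSchunck.exists_primitive_quotient (hX : X.IsSchunck) (hL : soluble F L) (h : ¬ X L) :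
    ∃ I : LieIdeal F L, IsPrimitive F (L ⧸ I) ∧ ¬ X (L ⧸ I) := by
  by_contra! hc
  exact h (hX.primitive_closed L hL hc)

theorem addIdeal_eq_top_of_isCoatom {U : LieSubalgebra F L} (hU : IsCoatom U) {I : LieIdeal F L}
    (hI : ¬ LieIdeal.toLieSubalgebra F L I ≤ U) : addIdeal U I = ⊤ := by
  refine (hU.le_iff.1 (le_addIdeal U I)).resolve_right fun h => hI ?_
  intro x hx
  rw [← h]
  exact mem_addIdeal_right U hx

/-- A maximal U containing no nonzero ideal supplements A, so U ∩ A is an ideal contained in U. -/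
theorem inf_eq_zero_of_core_free {U : LieSubalgebra F L} (hU : IsCoatom U)
    (hcore : ∀ I : LieIdeal F L, LieIdeal.toLieSubalgebra F L I ≤ U → I = ⊥)
    {A : LieIdeal F L} (hA : IsAbelianIdeal A) (h0 : A ≠ ⊥) :
    ∀ x ∈ U, x ∈ A → x = 0 := by
  have htop := addIdeal_eq_top_of_isCoatom hU fun h => h0 (hcore A h)
  intro x hx hx'
  have := hcore (interIdeal U A hA htop) fun y hy => hy.1
  rw [← LieSubmodule.mem_bot (R := F) (L := L) (M := L), ← this]
  exact ⟨hx, hx'⟩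

/-- A primitive Lie algebra has at most one nonzero abelian ideal. -/
theorem IsPrimitive.abelianIdeal_unique (hL : IsPrimitive F L) {A B : LieIdeal F L}
    (hA : IsAbelianIdeal A) (hB : IsAbelianIdeal B) (hA0 : A ≠ ⊥) (hB0 : B ≠ ⊥) : A = B := by
  obtain ⟨U, hU, hcore⟩ := hL
  have key : ∀ C D : LieIdeal F L, IsAbelianIdeal D → C ≤ D → C ≠ ⊥ → C = D := by
    intro C D hD hCD hC0
    refine le_antisymm hCD fun x hx => ?_
    have hD0 : D ≠ ⊥ := fun h => hC0 (le_bot_iff.1 (h ▸ hCD))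
    have htop := addIdeal_eq_top_of_isCoatom hU fun h => hC0 (hcore C h)
    obtain ⟨u, hu, c, hc, rfl⟩ := mem_addIdeal.1 (htop ▸ LieSubalgebra.mem_top x)
    have : u = 0 := inf_eq_zero_of_core_free hU hcore hD hD0 u hu (by
      simpa using D.sub_mem hx (hCD hc))
    rwa [this, zero_add]
  -- Comparable nonzero abelian ideals coincide by `key`. So compare A and B with A + B, which is
  -- abelian if A ∩ B = 0, and with A ∩ B otherwise.
  by_cases h : A ⊓ B = ⊥
  · have hsup : IsAbelianIdeal (A ⊔ B) := by
      have hab : ∀ a ∈ A, ∀ b ∈ B, ⁅a, b⁆ = 0 := by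
        intro a ha b hb
        rw [← LieSubmodule.mem_bot (R := F) (L := L) (M := L), ← h]
        exact ⟨by rw [← lie_skew]; exact A.neg_mem (A.lie_mem ha), B.lie_mem hb⟩
      intro x hx y hy
      obtain ⟨a, ha, b, hb, rfl⟩ := LieSubmodule.mem_sup _ _ _ |>.1 hx
      obtain ⟨a', ha', b', hb', rfl⟩ := LieSubmodule.mem_sup _ _ _ |>.1 hy
      rw [add_lie, lie_add, lie_add, hA a ha a' ha', hB b hb b' hb', hab a ha b' hb',
        ← lie_skew, hab a' ha' b hb]
      simp
    exact (key _ _ hsup le_sup_left hA0).trans (key _ _ hsup le_sup_right hB0).symm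
  · exact (key _ _ hA inf_le_left h).symm.trans (key _ _ hB inf_le_right h)

theorem IsAbelianIdeal.map {A : LieIdeal F L} (hA : IsAbelianIdeal A) {f : L →ₗ⁅F⁆ M}
    (hf : Function.Surjective f) : IsAbelianIdeal (A.map f) := by
  intro x hx y hy
  obtain ⟨a, rfl⟩ := LieIdeal.mem_map_of_surjective hf hx
  obtain ⟨b, rfl⟩ := LieIdeal.mem_map_of_surjective hf hy
  rw [← LieHom.map_lie, hA a a.2 b b.2, map_zero]

theorem IsAbelianIdeal.comap {A : LieIdeal F L} (hA : IsAbelianIdeal A) {f : M →ₗ⁅F⁆ L}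
    (hf : Function.Injective f) : IsAbelianIdeal (A.comap f) := by
  intro x hx y hy
  apply hf
  rw [LieHom.map_lie, map_zero]
  exact hA _ hx _ hy

theorem addIdeal_map_eq_top {U : LieSubalgebra F L} {A : LieIdeal F L} (h : addIdeal U A = ⊤)
    {f : L →ₗ⁅F⁆ M} (hf : Function.Surjective f) : addIdeal (U.map f) (A.map f) = ⊤ := by
  rw [eq_top_iff]
  intro y _
  obtain ⟨x, rfl⟩ := hf y
  obtain ⟨u, hu, a, ha, rfl⟩ := mem_addIdeal.1 (h ▸ LieSubalgebra.mem_top x)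
  exact mem_addIdeal.2 ⟨f u, mem_map_of_mem f hu, f a, LieIdeal.mem_map ha, (map_add f u a).symm⟩

theorem addIdeal_comap_incl_eq_top {U W : LieSubalgebra F L} {A : LieIdeal F L} (hUW : U ≤ W)
    (h : W ≤ addIdeal U A) : addIdeal (U.comap W.incl) (A.comap W.incl) = ⊤ := by
  rw [eq_top_iff]
  intro w _
  obtain ⟨u, hu, a, ha, hw⟩ := mem_addIdeal.1 (h w.2)
  have haW : a ∈ W := by
    have := W.sub_mem w.2 (hUW hu)
    rwa [← hw, add_sub_cancel_left] at this
  exact mem_addIdeal.2 ⟨⟨u, hUW hu⟩, hu, ⟨a, haW⟩, ha, Subtype.ext hw⟩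

/-- An `X`-maximal supplement `V` of an abelian ideal covers `L` modulo a minimal ideal `N` as soon
as `L ⧸ N` belongs to `X`. -/
theorem IsMaximalIn.map_quotMap_eq_top (hX : X.IsSchunck) (hL : soluble F L) {A : LieIdeal F L}
    (hA : IsAbelianIdeal A) {V : LieSubalgebra F L} (hV : X.IsMaximalIn V)
    (hVA : addIdeal V A = ⊤) {N : LieIdeal F L} (hN : IsAtom N) (hXN : X (L ⧸ N)) :
    V.map (quotMap N) = ⊤ := by
  by_cases hXL : X L
  · rw [hV.eq_top hX hXL, top_map_of_surjective (quotMap_surjective N)]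
  -- In the primitive quotient L/I outside X, both A and N have nonzero images: V + A = L but V does
  -- not cover L/I, and L/I is not a quotient of L/N. Hence A + I = N + I, so V + I is a complement
  -- of N, isomorphic to L/N. It lies in X and equals V by maximality.
  obtain ⟨I, hI, hXI⟩ := hX.exists_primitive_quotient hL hXL
  have hq := quotMap_surjective I
  have hVI : V.map (quotMap I) ≠ ⊤ := by
    intro h
    apply hXI
    have := hX.map hV.1 (quotMap I)
    rw [h] at this
    exact hX.top_iff.1 this
  have hNab := IsAbelianIdeal.of_atom hL hN
  have hA0 : A.map (quotMap I) ≠ ⊥ := by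
    intro h
    refine hVI (map_eq_top_of_addIdeal_eq_top hq (fun x hx => ?_) hVA)
    have := LieIdeal.mem_map (f := quotMap I) hx
    rwa [h] at this
  have hN0 : N.map (quotMap I) ≠ ⊥ := by
    intro h
    refine hXI (hX.of_surjective hXN (f := quotLift N (quotMap I) fun x hx => ?_) fun y => ?_)
    · have := LieIdeal.mem_map (f := quotMap I) hx
      rwa [h] at this
    · obtain ⟨x, rfl⟩ := hq y
      exact ⟨quotMap N x, rfl⟩
  have hAN := hI.abelianIdeal_unique (hA.map hq) (hNab.map hq) hA0 hN0
  have htop : addIdeal (addIdeal V I) N = ⊤ := by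
    rw [eq_top_iff]
    intro x _
    obtain ⟨v, hv, a, ha, rfl⟩ := mem_addIdeal.1 (hVA ▸ LieSubalgebra.mem_top x)
    obtain ⟨n, hn⟩ := LieIdeal.mem_map_of_surjective hq (hAN ▸ LieIdeal.mem_map ha)
    exact mem_addIdeal.2 ⟨v + (a - n), mem_addIdeal.2 ⟨v, hv, a - n,
      quotMap_eq_quotMap.1 hn.symm, rfl⟩, n, n.2, by abel⟩
  have hne : addIdeal V I ≠ ⊤ := by
    intro h
    exact hVI (map_eq_top_of_addIdeal_eq_top hq (fun x hx => quotMap_eq_zero.2 hx) h)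
  have hdisj := disjoint_of_atom hN hNab htop hne
  have hcov : (addIdeal V I).map (quotMap N) = ⊤ :=
    map_eq_top_of_addIdeal_eq_top (quotMap_surjective N) (fun x hx => quotMap_eq_zero.2 hx) htop
  have hXV : X (addIdeal V I) := by
    refine hX.of_map (f := quotMap N) (fun x hx h => hdisj x hx (quotMap_eq_zero.1 h)) ?_
    rw [hcov]
    exact hX.top_iff.2 hXN
  rw [← hV.2 _ (le_addIdeal V I) hXV, hcov]

theorem quotMap_not_injective {N : LieIdeal F L} (hN : N ≠ ⊥) :
    ¬ Function.Injective (quotMap N) := by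
  intro h
  refine hN (le_bot_iff.1 fun x hx => ?_)
  rw [LieSubmodule.mem_bot]
  exact h (by rw [quotMap_eq_zero.2 hx, map_zero])

/-- Induction on dimension: it suffices that maximality survives modulo a minimal ideal N. A
competitor S ≠ L/N is handled in its proper preimage W, where V supplements A ∩ W and so is a
projector by induction; S = L/N is `IsMaximalIn.map_quotMap_eq_top`. -/
theorem IsMaximalIn.isHomProjector_aux (hX : X.IsSchunck) (n : ℕ) :
    ∀ (L : Type u) [LieRing L] [LieAlgebra F L], soluble F L → Module.finrank F L < n →
    ∀ (A : LieIdeal F L), IsAbelianIdeal A → ∀ V : LieSubalgebra F L, X.IsMaximalIn V →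
    addIdeal V A = ⊤ → X.IsHomProjector V := by
  induction n with
  | zero => intro L _ _ _ h; exact absurd h (Nat.not_lt_zero _)
  | succ n ih =>
    intro L _ _ hL hn A hA V hV hVA Q _ _ f hf
    by_cases hi : Function.Injective f
    · exact hV.map hX ⟨hi, hf⟩
    obtain ⟨N, hN, hNf⟩ := exists_atom_le hL (ker_ne_bot hi)
    have hq := quotMap_surjective N
    let f' := quotLift N f fun x hx => LieHom.mem_ker.1 (hNf hx)
    have hf' : Function.Surjective f' := fun y => by
      obtain ⟨x, rfl⟩ := hf y
      exact ⟨quotMap N x, rfl⟩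
    have hlt := finrank_lt_of_surjective hL hq (quotMap_not_injective hN.1)
    have hmax : X.IsMaximalIn (V.map (quotMap N)) := by
      refine ⟨hX.map hV.1 _, fun S hVS hS => ?_⟩
      by_cases hST : S = ⊤
      · subst hST
        exact (hV.map_quotMap_eq_top hX hL hA hVA hN (hX.top_iff.1 hS)).symm
      refine le_antisymm ?_ hVS
      let W := S.comap (quotMap N)
      have hW : W ≠ ⊤ := by
        intro h
        apply hST
        rw [eq_top_iff]
        intro y _
        obtain ⟨x, rfl⟩ := hq y
        have : x ∈ W := h ▸ LieSubalgebra.mem_top x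
        exact this
      have hVW : V ≤ W := fun x hx => hVS (mem_map_of_mem _ hx)
      have hVmap := map_incl_comap hVW
      have hproj : X.IsHomProjector (V.comap W.incl) := by
        refine ih W (soluble_subalgebra hL W) ?_ (A.comap W.incl)
          (hA.comap Subtype.val_injective) _ ?_ (addIdeal_comap_incl_eq_top hVW ?_)
        · have := finrank_lt_of_ne_top hL hW
          omega
        · exact IsMaximalIn.of_map hX (f := W.incl) Subtype.val_injective (by rwa [hVmap])
        · rw [hVA]; exact le_top
      let k : W →ₗ⁅F⁆ S := codRestrict ((quotMap N).comp W.incl) S fun x => x.2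
      have hk : Function.Surjective k := by
        rintro ⟨y, hy⟩
        obtain ⟨x, rfl⟩ := hq y
        exact ⟨⟨x, hy⟩, rfl⟩
      have htop := (hproj _ k hk).eq_top hX hS
      intro y hy
      obtain ⟨w, hw, hwy⟩ := (LieSubalgebra.mem_map ..).1
        (htop ▸ LieSubalgebra.mem_top (⟨y, hy⟩ : S))
      have : quotMap N w = y := congrArg Subtype.val hwy
      rw [← this]
      exact mem_map_of_mem _ hw
    have hproj := ih (L ⧸ N) (soluble_quotient hL N) (by omega) (A.map (quotMap N))
      (hA.map hq) _ hmax (addIdeal_map_eq_top hVA hq)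
    have := hproj _ f' hf'
    rwa [map_map] at this

/-- An `X`-maximal subalgebra supplementing an abelian ideal is a projector. -/
theorem IsMaximalIn.isHomProjector (hX : X.IsSchunck) (hL : soluble F L) {A : LieIdeal F L}
    (hA : IsAbelianIdeal A) {V : LieSubalgebra F L} (hV : X.IsMaximalIn V)
    (hVA : addIdeal V A = ⊤) : X.IsHomProjector V :=
  isHomProjector_aux hX _ L hL (Nat.lt_succ_self _) A hA V hV hVA

/-- With N a minimal ideal of L and J = W ∩ N, induction applied to W/J inside L/N makes (U + J)/J a
projector of W/J. In U + J the maximal subalgebra U supplements the abelian ideal J, so it is a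
projector there, and `IsHomProjector.lift` carries it to W. -/
theorem IsHomProjector.of_map_aux (hX : X.IsSchunck) (n : ℕ) :
    ∀ (L : Type u) [LieRing L] [LieAlgebra F L], soluble F L → Module.finrank F L < n →
    ∀ (W : Type u) [LieRing W] [LieAlgebra F W] (i : W →ₗ⁅F⁆ L), Function.Injective i →
    ∀ U : LieSubalgebra F W, X.IsHomProjector (U.map i) → X.IsHomProjector U := by
  induction n with
  | zero => intro L _ _ _ h; exact absurd h (Nat.not_lt_zero _)
  | succ n ih =>
    intro L _ _ hL hn W _ _ i hi U hU
    by_cases hbot : (⊤ : LieIdeal F L) = ⊥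
    · refine IsHomProjector.of_bijective_map ⟨hi, fun y => ⟨0, ?_⟩⟩ hU
      have : y ∈ (⊥ : LieIdeal F L) := hbot ▸ LieSubmodule.mem_top y
      rw [LieSubmodule.mem_bot] at this
      rw [this, map_zero]
    obtain ⟨N, hN, -⟩ := exists_atom_le hL hbot
    have hq := quotMap_surjective N
    let J : LieIdeal F W := N.comap i
    let i' : W ⧸ J →ₗ⁅F⁆ L ⧸ N := quotLift J ((quotMap N).comp i) fun x hx =>
      quotMap_eq_zero.2 hx
    have hi' : Function.Injective i' := by
      rw [injective_iff_map_eq_zero]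
      intro y hy
      obtain ⟨x, rfl⟩ := quotMap_surjective J y
      exact quotMap_eq_zero.2 (quotMap_eq_zero.1 hy : i x ∈ N)
    have hlt := finrank_lt_of_surjective hL hq (quotMap_not_injective hN.1)
    have hUJ : X.IsHomProjector (U.map (quotMap J)) := by
      refine ih (L ⧸ N) (soluble_quotient hL N) (by omega) (W ⧸ J) i' hi' _ ?_
      have := hU.map hq
      rw [map_map] at this ⊢
      exact this
    let T := addIdeal U J
    have hUT : U ≤ T := le_addIdeal U J
    have hmax : X.IsMaximalIn (U.comap T.incl) :=
      IsMaximalIn.of_map hX (f := T.incl) Subtype.val_injective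
        (by rw [map_incl_comap hUT]; exact IsMaximalIn.of_map hX hi hU.isMaximalIn)
    have hproj := hmax.isHomProjector hX (soluble_subalgebra (soluble_of_injective hL hi) T)
      (((IsAbelianIdeal.of_atom hL hN).comap hi).comap Subtype.val_injective)
      (addIdeal_comap_incl_eq_top hUT le_rfl)
    have := IsHomProjector.lift hX (i := T.incl) (N := J)
      (fun x hx => ⟨⟨x, mem_addIdeal_right U hx⟩, rfl⟩)
      (by rw [LieSubalgebra.incl_range, map_quotMap_addIdeal]; exact hUJ) hproj
    rwa [map_incl_comap hUT] at this

/-- A projector is a projector of every intermediate subalgebra. -/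
theorem IsHomProjector.of_map (hX : X.IsSchunck) (hL : soluble F L) {i : M →ₗ⁅F⁆ L}
    (hi : Function.Injective i) {U : LieSubalgebra F M} (hU : X.IsHomProjector (U.map i)) :
    X.IsHomProjector U :=
  of_map_aux hX _ L hL (Nat.lt_succ_self _) M i hi U hU

theorem IsHomProjector.comap_incl (hX : X.IsSchunck) (hL : soluble F L) {U W : LieSubalgebra F L}
    (hU : X.IsHomProjector U) (hUW : U ≤ W) : X.IsHomProjector (U.comap W.incl) :=
  IsHomProjector.of_map hX hL (i := W.incl) Subtype.val_injective (by rwa [map_incl_comap hUW])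

end LieClass

/-! ### Centralizers and the action of an ideal on a minimal ideal -/

namespace LieClass

variable {F : Type u} [Field F]
variable {X : LieClass F}
variable {L : Type u} [LieRing L] [LieAlgebra F L] {M : Type u} [LieRing M] [LieAlgebra F M]

/-- The centralizer of an ideal, as an ideal. -/
def idealCentralizer (N : LieIdeal F L) : LieIdeal F L where
  carrier := {z | ∀ n ∈ N, ⁅z, n⁆ = 0}
  add_mem' := by
    intro a b ha hb n hn
    rw [add_lie, ha n hn, hb n hn, add_zero]
  zero_mem' := fun n _ => zero_lie n
  smul_mem' := by
    intro c a ha n hn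
    rw [smul_lie, ha n hn, smul_zero]
  lie_mem := by
    intro x z hz n hn
    rw [lie_lie, hz n hn, hz _ (N.lie_mem hn), lie_zero, sub_zero]

section Fitting

variable {N E : LieIdeal F L}

theorem ad_pow_mem (e : L) {n : L} (hn : n ∈ N) (k : ℕ) : ((LieAlgebra.ad F L e) ^ k) n ∈ N := by
  induction k with
  | zero => exact hn
  | succ k ih => rw [pow_succ']; exact N.lie_mem ih

theorem ad_pow_lie_of_commute (hE : ∀ x ∈ E, ∀ y ∈ E, ⁅x, y⁆ ∈ idealCentralizer N) {e f n : L}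
    (he : e ∈ E) (hf : f ∈ E) (hn : n ∈ N) (k : ℕ) :
    ((LieAlgebra.ad F L e) ^ k) ⁅f, n⁆ = ⁅f, ((LieAlgebra.ad F L e) ^ k) n⁆ := by
  induction k with
  | zero => rfl
  | succ k ih =>
    rw [pow_succ', Module.End.mul_apply, Module.End.mul_apply, ih, LieAlgebra.ad_apply,
      leibniz_lie, hE e he f hf _ (ad_pow_mem e hn k), zero_add, LieAlgebra.ad_apply]

/-- In [e, [x, n]] = [[e, x], n] + [x, [e, n]] the element [e, x] lies in E, so its action on N
commutes with that of e. This makes the Fitting null component of e invariant under all of L. -/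
theorem ad_pow_succ_lie_eq_zero (hE : ∀ x ∈ E, ∀ y ∈ E, ⁅x, y⁆ ∈ idealCentralizer N) {e : L}
    (he : e ∈ E) (k : ℕ) : ∀ n ∈ N, ((LieAlgebra.ad F L e) ^ k) n = 0 → ∀ x : L,
      ((LieAlgebra.ad F L e) ^ (k + 1)) ⁅x, n⁆ = 0 := by
  induction k with
  | zero =>
    intro n _ h x
    rw [pow_zero, Module.End.one_apply] at h
    rw [h, lie_zero, map_zero]
  | succ k ih =>
    intro n hn h x
    have hfe : ⁅e, x⁆ ∈ E := by
      rw [← lie_skew]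
      exact E.neg_mem (E.lie_mem he)
    rw [pow_succ, Module.End.mul_apply, LieAlgebra.ad_apply, leibniz_lie, map_add,
      ad_pow_lie_of_commute hE he hfe hn, h, lie_zero, zero_add]
    rw [pow_succ, Module.End.mul_apply] at h
    exact ih _ (N.lie_mem hn) h x

/-- The Fitting null component of an element of `E` on `N`, when the action of `E` on `N` is
commutative. -/
def fittingNull (hE : ∀ x ∈ E, ∀ y ∈ E, ⁅x, y⁆ ∈ idealCentralizer N) (e : L) (he : e ∈ E) :
    LieIdeal F L where
  toSubmodule := N.toSubmodule ⊓ Module.End.maxGenEigenspace (LieAlgebra.ad F L e) 0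
  lie_mem := by
    rintro x n ⟨hn, hn'⟩
    refine ⟨N.lie_mem hn, ?_⟩
    rw [SetLike.mem_coe, Module.End.mem_maxGenEigenspace] at hn' ⊢
    obtain ⟨k, hk⟩ := hn'
    rw [zero_smul, sub_zero] at hk ⊢
    exact ⟨k + 1, ad_pow_succ_lie_eq_zero hE he k n hn hk x⟩

theorem mem_fittingNull {hE : ∀ x ∈ E, ∀ y ∈ E, ⁅x, y⁆ ∈ idealCentralizer N} {e : L} {he : e ∈ E}
    {n : L} : n ∈ fittingNull hE e he ↔ n ∈ N ∧ ∃ k : ℕ, ((LieAlgebra.ad F L e) ^ k) n = 0 := by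
  refine and_congr Iff.rfl ?_
  rw [SetLike.mem_coe, Module.End.mem_maxGenEigenspace, zero_smul, sub_zero]

/-- The elements of `N` annihilated by `E`. -/
def annihilated (N E : LieIdeal F L) : LieIdeal F L where
  carrier := {n | n ∈ N ∧ ∀ e ∈ E, ⁅e, n⁆ = 0}
  add_mem' := by
    rintro a b ⟨ha, ha'⟩ ⟨hb, hb'⟩
    exact ⟨N.add_mem ha hb, fun e he => by rw [lie_add, ha' e he, hb' e he, add_zero]⟩
  zero_mem' := ⟨N.zero_mem, fun e _ => lie_zero e⟩
  smul_mem' := by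
    rintro c a ⟨ha, ha'⟩
    exact ⟨N.smul_mem c ha, fun e he => by rw [lie_smul, ha' e he, smul_zero]⟩
  lie_mem := by
    rintro x n ⟨hn, hn'⟩
    refine ⟨N.lie_mem hn, fun e he => ?_⟩
    have hfe : ⁅e, x⁆ ∈ E := by
      rw [← lie_skew]
      exact E.neg_mem (E.lie_mem he)
    rw [leibniz_lie, hn' _ hfe, hn' e he, lie_zero, add_zero]

/-- If every e in E had a kernel on N, its Fitting null component would be a nonzero ideal inside N,
hence N. Then E acts nilpotently by Engel, so it annihilates a nonzero element of N. The annihilated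
elements form an ideal, so E would centralize N. -/
theorem exists_injective_ad (hL : soluble F L) (hN : IsAtom N)
    (hE : ∀ x ∈ E, ∀ y ∈ E, ⁅x, y⁆ ∈ idealCentralizer N) (hEN : ¬ E ≤ idealCentralizer N) :
    ∃ e ∈ E, ∀ n ∈ N, ⁅e, n⁆ = 0 → n = 0 := by
  obtain ⟨hfin, -⟩ := hL
  by_contra! hc
  have hnil : ∀ e ∈ E, ∀ n ∈ N, ∃ k : ℕ, ((LieAlgebra.ad F L e) ^ k) n = 0 := by
    intro e he n hn
    have hle : fittingNull hE e he ≤ N := fun x hx => hx.1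
    have hne : fittingNull hE e he ≠ ⊥ := by
      obtain ⟨m, hm, hem, hm0⟩ := hc e he
      intro h
      have : m ∈ fittingNull hE e he := mem_fittingNull.2 ⟨hm, 1, by rwa [pow_one]⟩
      rw [h, LieSubmodule.mem_bot] at this
      exact hm0 this
    have := (hN.le_iff.1 hle).resolve_left hne
    rw [← this] at hn
    exact (mem_fittingNull.1 hn).2
  have hEngel : LieModule.IsNilpotent E N := by
    rw [LieModule.isNilpotent_iff_forall (R := F)]
    intro e
    rw [Module.End.isNilpotent_iff_of_finite]
    intro n
    obtain ⟨k, hk⟩ := hnil e e.2 n n.2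
    refine ⟨k, Subtype.ext ?_⟩
    have : ∀ j : ℕ, (((LieModule.toEnd F E N e) ^ j) n : L) =
        ((LieAlgebra.ad F L (e : L)) ^ j) (n : L) := by
      intro j
      induction j with
      | zero => rfl
      | succ j ih =>
        rw [pow_succ', pow_succ', Module.End.mul_apply, Module.End.mul_apply, ← ih]
        rfl
    rw [this, hk]
    rfl
  have : Nontrivial N := by
    rw [LieSubmodule.nontrivial_iff_ne_bot]
    exact hN.1
  have htriv := LieModule.nontrivial_max_triv_of_isNilpotent F E N
  obtain ⟨m, hm⟩ := exists_ne (0 : LieModule.maxTrivSubmodule F E N)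
  have hne : annihilated N E ≠ ⊥ := by
    intro h
    have hmem : ((m : N) : L) ∈ annihilated N E := by
      refine ⟨(m : N).2, fun e he => ?_⟩
      exact congrArg Subtype.val ((LieModule.mem_maxTrivSubmodule F E N _).1 m.2 ⟨e, he⟩)
    rw [h, LieSubmodule.mem_bot] at hmem
    exact hm (Subtype.ext (Subtype.ext hmem))
  have heq : annihilated N E = N :=
    (hN.le_iff.1 (fun x hx => hx.1 : annihilated N E ≤ N)).resolve_left hne
  refine hEN fun e he n hn => ?_
  rw [← heq] at hn
  exact hn.2 e he

/-- The last term of the derived series not contained in Z works. -/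
theorem exists_derived_not_le (hL : soluble F L) {Z : LieIdeal F L} (hZ : Z ≠ ⊤) :
    ∃ E : LieIdeal F L, ¬ E ≤ Z ∧ ∀ x ∈ E, ∀ y ∈ E, ⁅x, y⁆ ∈ Z := by
  classical
  obtain ⟨-, hs⟩ := hL
  have hex : ∃ k, LieAlgebra.derivedSeries F L k ≤ Z := by
    obtain ⟨k, hk⟩ := LieAlgebra.IsSolvable.solvable F L
    exact ⟨k, hk ▸ bot_le⟩
  obtain ⟨k, hk⟩ : ∃ k, Nat.find hex = k + 1 := by
    refine Nat.exists_eq_succ_of_ne_zero fun h => hZ (top_le_iff.1 ?_)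
    have := Nat.find_spec hex
    rwa [h] at this
  refine ⟨LieAlgebra.derivedSeries F L k, Nat.find_min hex (by omega), fun x hx y hy => ?_⟩
  have := Nat.find_spec hex
  rw [hk, LieAlgebra.derivedSeries_def, LieAlgebra.derivedSeriesOfIdeal_succ] at this
  exact this (LieSubmodule.lie_mem_lie hx hy)

end Fitting

/-! ### Conjugacy of projectors under an abelian ideal -/

section Conjugacy

variable {U V : LieSubalgebra F L} {N : LieIdeal F L}

/-- The automorphism `1 + ad a` for `a` in an abelian ideal. -/
def oneAddAd {A : LieIdeal F L} (hA : IsAbelianIdeal A) {a : L} (ha : a ∈ A) : L →ₗ⁅F⁆ L where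
  toLinearMap := LinearMap.id + (LieAlgebra.ad F L a : L →ₗ[F] L)
  map_lie' := by
    intro x y
    have hmem : ∀ z, ⁅a, z⁆ ∈ A := fun z => by
      rw [← lie_skew]
      exact A.neg_mem (A.lie_mem ha)
    change ⁅x, y⁆ + ⁅a, ⁅x, y⁆⁆ = ⁅x + ⁅a, x⁆, y + ⁅a, y⁆⁆
    rw [add_lie, lie_add, lie_add, hA _ (hmem x) _ (hmem y), leibniz_lie a x y]
    abel

theorem oneAddAd_apply {A : LieIdeal F L} (hA : IsAbelianIdeal A) {a : L} (ha : a ∈ A) (x : L) :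
    oneAddAd hA ha x = x + ⁅a, x⁆ := rfl

theorem oneAddAd_bijective {A : LieIdeal F L} (hA : IsAbelianIdeal A) {a : L} (ha : a ∈ A) :
    Function.Bijective (oneAddAd hA ha) := by
  have hsq : ∀ z : L, ⁅a, ⁅a, z⁆⁆ = 0 := fun z => hA _ ha _ (by
    rw [← lie_skew]
    exact A.neg_mem (A.lie_mem ha))
  refine Function.bijective_iff_has_inverse.2 ⟨fun x => x - ⁅a, x⁆, fun x => ?_, fun x => ?_⟩
  · simp only [oneAddAd_apply, lie_add, hsq]
    abel
  · simp only [oneAddAd_apply, lie_sub, hsq]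
    abel

/-- D = V ∩ C(N) is an ideal, since V + N = L and N centralizes D. If D were not inside U, then U +
D = L because U complements N; so L/D is in X, V covers it, and V = V + D = L. -/
theorem mem_of_mem_centralizer (hX : X.IsSchunck) (hL : soluble F L) (hN : IsAtom N)
    (hU : X.IsHomProjector U) (hV : X.IsHomProjector V) (hUN : addIdeal U N = ⊤)
    (hVN : addIdeal V N = ⊤) (hV1 : V ≠ ⊤) : ∀ x ∈ V, x ∈ idealCentralizer N → x ∈ U := by
  have hNab := IsAbelianIdeal.of_atom hL hN
  let D : LieIdeal F L :=
    { toSubmodule := V.toSubmodule ⊓ (idealCentralizer N).toSubmodule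
      lie_mem := by
        rintro x d ⟨hd, hd'⟩
        refine ⟨?_, (idealCentralizer N).lie_mem hd'⟩
        obtain ⟨v, hv, n, hn, rfl⟩ := mem_addIdeal.1 (hVN ▸ LieSubalgebra.mem_top x)
        have : ⁅v + n, d⁆ = ⁅v, d⁆ := by
          rw [add_lie, ← lie_skew n d, hd' n hn, neg_zero, add_zero]
        rw [this]
        exact V.lie_mem hv hd }
  intro d hd hdZ
  by_contra hdU
  have hDtop : addIdeal U D = ⊤ := by
    by_contra hne
    have hsup : addIdeal (addIdeal U D) N = ⊤ := by
      rw [eq_top_iff]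
      intro x _
      obtain ⟨u, hu, n, hn, h⟩ := mem_addIdeal.1 (hUN ▸ LieSubalgebra.mem_top x)
      exact mem_addIdeal.2 ⟨u, le_addIdeal U D hu, n, hn, h⟩
    have hdisj := disjoint_of_atom hN hNab hsup hne
    have hdS : d ∈ addIdeal U D := mem_addIdeal_right U (⟨hd, hdZ⟩ : d ∈ D)
    obtain ⟨u, hu, n, hn, rfl⟩ := mem_addIdeal.1 (hUN ▸ LieSubalgebra.mem_top d)
    have hn0 : n = 0 := hdisj n (by
      simpa using (addIdeal U D).sub_mem hdS (le_addIdeal U D hu)) hn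
    rw [hn0, add_zero] at hdU
    exact hdU hu
  have hq := quotMap_surjective D
  have h1 : U.map (quotMap D) = ⊤ :=
    map_eq_top_of_addIdeal_eq_top hq (fun x hx => quotMap_eq_zero.2 hx) hDtop
  have hXD : X (L ⧸ D) := by
    have := hX.map hU.isMaximalIn.1 (quotMap D)
    rw [h1] at this
    exact hX.top_iff.1 this
  have h2 := addIdeal_eq_top_of_map_eq_top ((hV _ _ hq).eq_top hX hXD)
  apply hV1
  rw [eq_top_iff]
  intro x _
  obtain ⟨v, hv, e, he, rfl⟩ := mem_addIdeal.1 (h2 ▸ LieSubalgebra.mem_top x)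
  exact V.add_mem hv he.1

/-- If u = v + n and [e, u] lies in V, then [e, n] lies in V ∩ N = 0, so n = 0. Apply this first to
u in U ∩ E, where [e, u] centralizes N, and then to any u in U, where [e, u] lies in U ∩ E. -/
theorem le_of_common_injective {E : LieIdeal F L}
    (hE : ∀ x ∈ E, ∀ y ∈ E, ⁅x, y⁆ ∈ idealCentralizer N)
    (hZ : ∀ x ∈ U, x ∈ idealCentralizer N → x ∈ V) (hVN : addIdeal V N = ⊤)
    (hdisj : ∀ x ∈ V, x ∈ N → x = 0) {e : L} (heE : e ∈ E) (heU : e ∈ U) (heV : e ∈ V)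
    (hinj : ∀ n ∈ N, ⁅e, n⁆ = 0 → n = 0) : U ≤ V := by
  have key : ∀ u ∈ U, ⁅e, u⁆ ∈ V → u ∈ V := by
    intro u hu huV
    obtain ⟨v, hv, n, hn, rfl⟩ := mem_addIdeal.1 (hVN ▸ LieSubalgebra.mem_top u)
    have h1 : ⁅e, n⁆ ∈ V := by
      have := V.sub_mem huV (V.lie_mem heV hv)
      rwa [lie_add, add_sub_cancel_left] at this
    rw [hinj n hn (hdisj _ h1 (N.lie_mem hn)), add_zero]
    exact hv
  have keyE : ∀ u ∈ U, u ∈ E → u ∈ V := fun u hu huE =>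
    key u hu (hZ _ (U.lie_mem heU hu) (hE e heE u huE))
  intro u hu
  refine key u hu (keyE _ (U.lie_mem heU hu) ?_)
  rw [← lie_skew]
  exact E.neg_mem (E.lie_mem heE)

/-- Projectors supplementing a minimal ideal `N` are conjugate under `1 + ad N`. -/
theorem IsHomProjector.conjugate_of_atom (hX : X.IsSchunck) (hL : soluble F L) (hN : IsAtom N)
    (hU : X.IsHomProjector U) (hV : X.IsHomProjector V) (hUN : addIdeal U N = ⊤)
    (hVN : addIdeal V N = ⊤) : ∃ a ∈ N, ∀ x, x ∈ V ↔ ∃ u ∈ U, u + ⁅a, u⁆ = x := by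
  have hNab := IsAbelianIdeal.of_atom hL hN
  have of_eq : U = V → ∃ a ∈ N, ∀ x, x ∈ V ↔ ∃ u ∈ U, u + ⁅a, u⁆ = x := by
    rintro rfl
    exact ⟨0, N.zero_mem, fun x => by simp⟩
  by_cases hXL : X L
  · exact of_eq ((hU.isMaximalIn.eq_top hX hXL).trans (hV.isMaximalIn.eq_top hX hXL).symm)
  have hne : ∀ S : LieSubalgebra F L, X.IsHomProjector S → S ≠ ⊤ := by
    rintro S hS rfl
    exact hXL (hX.top_iff.1 hS.isMaximalIn.1)
  have hVdisj := disjoint_of_atom hN hNab hVN (hne V hV)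
  by_cases hZ : idealCentralizer N = ⊤
  · refine of_eq (hV.isMaximalIn.2 U (fun x hx => ?_) hU.isMaximalIn.1)
    exact mem_of_mem_centralizer hX hL hN hU hV hUN hVN (hne V hV) x hx
      (hZ ▸ LieSubmodule.mem_top x)
  obtain ⟨E₀, hE₀Z, hE₀⟩ := exists_derived_not_le hL hZ
  have hNZ : N ≤ idealCentralizer N := fun x hx n hn => hNab x hx n hn
  -- Adding N allows elements of the ideal to be adjusted by N, which acts trivially on itself, when
  -- moving them into U or V.
  have hE : ∀ x ∈ E₀ ⊔ N, ∀ y ∈ E₀ ⊔ N, ⁅x, y⁆ ∈ idealCentralizer N := by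
    intro x hx y hy
    obtain ⟨e, he, n, hn, rfl⟩ := (LieSubmodule.mem_sup _ _ _).1 hx
    obtain ⟨e', he', n', hn', rfl⟩ := (LieSubmodule.mem_sup _ _ _).1 hy
    rw [add_lie, lie_add]
    refine add_mem (add_mem (hE₀ e he e' he') ((idealCentralizer N).lie_mem (hNZ hn'))) ?_
    rw [← lie_skew]
    exact neg_mem ((idealCentralizer N).lie_mem (hNZ hn))
  obtain ⟨e₀, he₀, hinj₀⟩ := exists_injective_ad hL hN hE fun h => hE₀Z (le_sup_left.trans h)
  -- move the distinguished element into `U`, then conjugate it into `V`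
  obtain ⟨e, heU, n, hn, rfl⟩ := mem_addIdeal.1 (hUN ▸ LieSubalgebra.mem_top e₀)
  have hNE : ∀ {x}, x ∈ N → x ∈ E₀ ⊔ N := fun hx => le_sup_right (a := E₀) hx
  have heE : e ∈ E₀ ⊔ N := by simpa using sub_mem he₀ (hNE hn)
  have hinj : ∀ m ∈ N, ⁅e, m⁆ = 0 → m = 0 := fun m hm h =>
    hinj₀ m hm (by rw [add_lie, h, hNab n hn m hm, add_zero])
  obtain ⟨v, hvV, n', hn', hv⟩ := mem_addIdeal.1 (hVN ▸ LieSubalgebra.mem_top e)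
  -- Injectivity of ad e on the finite-dimensional N gives surjectivity; then (1 + ad a) e = e - n'
  -- = v.
  have hsurj : ∃ a ∈ N, ⁅e, a⁆ = n' := by
    obtain ⟨hfin, -⟩ := hL
    let g : N →ₗ[F] N := LieModule.toEnd F L N e
    have hg : Function.Injective g := by
      rw [injective_iff_map_eq_zero]
      intro m hm
      exact Subtype.ext (hinj m m.2 (congrArg Subtype.val hm))
    obtain ⟨a, ha⟩ := LinearMap.surjective_of_injective hg ⟨n', hn'⟩
    exact ⟨a, a.2, congrArg Subtype.val ha⟩
  obtain ⟨a, ha, hea⟩ := hsurj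
  have hσ := oneAddAd_bijective hNab ha
  have hmem : ∀ z, ⁅a, z⁆ ∈ N := fun z => by
    rw [← lie_skew]
    exact N.neg_mem (N.lie_mem ha)
  have hU₁ := hU.map hσ.2
  have hU₁N : addIdeal (U.map (oneAddAd hNab ha)) N = ⊤ := by
    rw [eq_top_iff]
    intro x _
    obtain ⟨u, hu, m, hm, rfl⟩ := mem_addIdeal.1 (hUN ▸ LieSubalgebra.mem_top x)
    refine mem_addIdeal.2 ⟨_, mem_map_of_mem _ hu, m - ⁅a, u⁆, sub_mem hm (hmem u), ?_⟩
    rw [oneAddAd_apply]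
    abel
  have hve : oneAddAd hNab ha e = v := by
    rw [oneAddAd_apply, ← lie_skew, hea, ← hv]
    abel
  have hvinj : ∀ m ∈ N, ⁅v, m⁆ = 0 → m = 0 := fun m hm h =>
    hinj m hm (by rw [← hv, add_lie, h, hNab n' hn' m hm, add_zero])
  have hvE : v ∈ E₀ ⊔ N := by
    have := sub_mem heE (hNE hn')
    rwa [← hv, add_sub_cancel_right] at this
  have hle : U.map (oneAddAd hNab ha) ≤ V :=
    le_of_common_injective hE
      (mem_of_mem_centralizer hX hL hN hV hU₁ hVN hU₁N (hne _ hU₁)) hVN hVdisj hvE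
      (hve ▸ mem_map_of_mem _ heU) hvV hvinj
  have heq := hU₁.isMaximalIn.2 V hle hV.isMaximalIn.1
  refine ⟨a, ha, fun x => ?_⟩
  rw [heq, LieSubalgebra.mem_map]
  rfl

/-- Conjugate modulo a minimal ideal N ≤ A, lift, and then conjugate under N inside V + N. If V + N
is proper, N need not be minimal in it, which is why the induction runs over abelian ideals. -/
theorem IsHomProjector.conjugate_aux (hX : X.IsSchunck) (n : ℕ) :
    ∀ (L : Type u) [LieRing L] [LieAlgebra F L], soluble F L → Module.finrank F L < n →
    ∀ A : LieIdeal F L, IsAbelianIdeal A → ∀ U V : LieSubalgebra F L, X.IsHomProjector U →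
    X.IsHomProjector V → addIdeal U A = ⊤ → addIdeal V A = ⊤ →
    ∃ a ∈ A, ∀ x, x ∈ V ↔ ∃ u ∈ U, u + ⁅a, u⁆ = x := by
  induction n with
  | zero => intro L _ _ _ h; exact absurd h (Nat.not_lt_zero _)
  | succ n ih =>
    intro L _ _ hL hn A hA U V hU hV hUA hVA
    by_cases hA0 : A = ⊥
    · subst hA0
      have htop : ∀ S : LieSubalgebra F L, addIdeal S ⊥ = ⊤ → ∀ x, x ∈ S := by
        intro S hS x
        obtain ⟨s, hs, b, hb, rfl⟩ := mem_addIdeal.1 (hS ▸ LieSubalgebra.mem_top x)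
        rw [LieSubmodule.mem_bot] at hb
        rwa [hb, add_zero]
      exact ⟨0, LieSubmodule.zero_mem _, fun x => by simp [htop U hUA, htop V hVA]⟩
    obtain ⟨N, hN, hNA⟩ := exists_atom_le hL hA0
    have hNab := IsAbelianIdeal.of_atom hL hN
    have hq := quotMap_surjective N
    have hlt := finrank_lt_of_surjective hL hq (quotMap_not_injective hN.1)
    obtain ⟨a', ha', hconj⟩ := ih (L ⧸ N) (soluble_quotient hL N) (by omega) _ (hA.map hq)
      _ _ (hU.map hq) (hV.map hq) (addIdeal_map_eq_top hUA hq) (addIdeal_map_eq_top hVA hq)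
    obtain ⟨⟨a, ha⟩, rfl⟩ := LieIdeal.mem_map_of_surjective hq ha'
    let U₁ := U.map (oneAddAd hA ha)
    have hU₁ : X.IsHomProjector U₁ := hU.map (oneAddAd_bijective hA ha).2
    have hmap : U₁.map (quotMap N) = V.map (quotMap N) := by
      ext y
      rw [hconj y, map_map, LieSubalgebra.mem_map]
      constructor
      · rintro ⟨u, hu, rfl⟩
        exact ⟨quotMap N u, mem_map_of_mem _ hu, rfl⟩
      · rintro ⟨_, hu, rfl⟩
        obtain ⟨u, hu', rfl⟩ := (LieSubalgebra.mem_map ..).1 hu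
        exact ⟨u, hu', rfl⟩
    have hadd : addIdeal U₁ N = addIdeal V N := by rw [addIdeal, hmap]; rfl
    have hstep : ∃ b ∈ N, ∀ x, x ∈ V ↔ ∃ u ∈ U₁, u + ⁅b, u⁆ = x := by
      by_cases htop : addIdeal V N = ⊤
      · exact hU₁.conjugate_of_atom hX hL hN hV (hadd.trans htop) htop
      let W := addIdeal V N
      have hVW : V ≤ W := le_addIdeal V N
      have hUW : U₁ ≤ W := (le_addIdeal U₁ N).trans hadd.le
      have hltW : Module.finrank F W < Module.finrank F L := finrank_lt_of_ne_top hL htop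
      obtain ⟨b, hb, hbc⟩ := ih W (soluble_subalgebra hL W) (by omega) (N.comap W.incl)
        (hNab.comap Subtype.val_injective) _ _ (hU₁.comap_incl hX hL hUW)
        (hV.comap_incl hX hL hVW) (addIdeal_comap_incl_eq_top hUW hadd.ge)
        (addIdeal_comap_incl_eq_top hVW le_rfl)
      refine ⟨b, hb, fun x => ⟨fun hx => ?_, ?_⟩⟩
      · obtain ⟨u, hu, h⟩ := (hbc ⟨x, hVW hx⟩).1 hx
        exact ⟨u, hu, congrArg Subtype.val h⟩
      · rintro ⟨u, hu, rfl⟩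
        exact (hbc (⟨u, hUW hu⟩ + ⁅b, ⟨u, hUW hu⟩⁆)).2 ⟨⟨u, hUW hu⟩, hu, rfl⟩
    obtain ⟨b, hb, hbc⟩ := hstep
    refine ⟨a + b, add_mem ha (hNA hb), fun x => ?_⟩
    have hcomp : ∀ u : L, (u + ⁅a, u⁆) + ⁅b, u + ⁅a, u⁆⁆ = u + ⁅a + b, u⁆ := by
      intro u
      have : ⁅b, ⁅a, u⁆⁆ = 0 := hA b (hNA hb) _ (by
        rw [← lie_skew]
        exact A.neg_mem (A.lie_mem ha))
      rw [lie_add, this, add_lie]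
      abel
    rw [hbc]
    constructor
    · rintro ⟨_, hu, rfl⟩
      obtain ⟨u, hu', rfl⟩ := (LieSubalgebra.mem_map ..).1 hu
      exact ⟨u, hu', (hcomp u).symm⟩
    · rintro ⟨u, hu, rfl⟩
      exact ⟨u + ⁅a, u⁆, mem_map_of_mem (oneAddAd hA ha) hu, hcomp u⟩

/-- Projectors with the same sum with an abelian ideal are conjugate under that ideal, here in the
case that this sum is the whole algebra. -/
theorem IsHomProjector.conjugate (hX : X.IsSchunck) (hL : soluble F L) {A : LieIdeal F L}
    (hA : IsAbelianIdeal A) (hU : X.IsHomProjector U) (hV : X.IsHomProjector V)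
    (hUA : addIdeal U A = ⊤) (hVA : addIdeal V A = ⊤) :
    ∃ a ∈ A, ∀ x, x ∈ V ↔ ∃ u ∈ U, u + ⁅a, u⁆ = x :=
  conjugate_aux hX _ L hL (Nat.lt_succ_self _) A hA U V hU hV hUA hVA

end Conjugacy

end LieClass

/-! ### Boundary, avoidance class and strong containment -/

namespace LieClass

variable {F : Type u} [Field F]
variable {X H K : LieClass F}
variable {L : Type u} [LieRing L] [LieAlgebra F L] {M : Type u} [LieRing M] [LieAlgebra F M]

theorem IsPrimitive.of_bijective (hM : IsPrimitive F M) {f : L →ₗ⁅F⁆ M}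
    (hf : Function.Bijective f) : IsPrimitive F L := by
  obtain ⟨S, hS, hcore⟩ := hM
  have hrange : ∀ T : LieSubalgebra F M, (T.comap f).map f = T := fun T =>
    map_comap_of_le_range fun y _ => hf.2 y
  refine ⟨S.comap f, ⟨fun h => hS.1 ?_, fun T hT => ?_⟩, fun I hI => ?_⟩
  · rw [← hrange S, h, top_map_of_surjective hf.2]
  · have h1 : S ≤ T.map f := by
      rw [← hrange S]
      exact map_mono f hT.le
    rw [← comap_map_of_injective hf.1 T]
    rcases hS.le_iff.1 h1 with h | h
    · rw [h]; rfl
    · exact absurd (by rw [← h, comap_map_of_injective hf.1]) hT.ne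
  · have hbot : I.map f = ⊥ := by
      refine hcore _ fun y hy => ?_
      obtain ⟨x, rfl⟩ := LieIdeal.mem_map_of_surjective hf.2 hy
      exact hI x.2
    refine le_bot_iff.1 fun x hx => ?_
    have := LieIdeal.mem_map (f := f) hx
    rw [hbot, LieSubmodule.mem_bot] at this
    rw [LieSubmodule.mem_bot]
    exact hf.1 (by rw [this, map_zero])

theorem IsSchunck.isPrimitive_of_boundary (hX : X.IsSchunck) (hL : X.boundary L) :
    IsPrimitive F L := by
  obtain ⟨hsol, hnot, hquot⟩ := hL
  obtain ⟨I, hI, hXI⟩ := hX.exists_primitive_quotient hsol hnot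
  obtain rfl : I = ⊥ := by
    by_contra h
    exact hXI (hquot I h)
  exact hI.of_bijective ⟨quotMap_bot_injective, quotMap_surjective _⟩

/-- In an algebra on the boundary of `X`, a maximal subalgebra complementing a minimal ideal and
containing no nonzero ideal is an `X`-projector. -/
theorem IsSchunck.isHomProjector_of_boundary (hX : X.IsSchunck) (hL : X.boundary L)
    {U : LieSubalgebra F L} (hU : IsCoatom U)
    (hcore : ∀ I : LieIdeal F L, LieIdeal.toLieSubalgebra F L I ≤ U → I = ⊥)
    (hXU : X U) : X.IsHomProjector U := by
  obtain ⟨hsol, hnot, hquot⟩ := hL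
  intro Q _ _ f hf
  by_cases hi : Function.Injective f
  · refine IsMaximalIn.map hX ⟨hi, hf⟩ ⟨hXU, fun V hUV hV => ?_⟩
    refine (hU.le_iff.1 hUV).resolve_left ?_
    rintro rfl
    exact hnot (hX.top_iff.1 hV)
  · have htop := addIdeal_eq_top_of_isCoatom hU fun h => ker_ne_bot hi (hcore _ h)
    rw [map_eq_top_of_addIdeal_eq_top hf (fun x hx => LieHom.mem_ker.1 hx) htop]
    exact hX.isMaximalIn_top (hX.of_surjective (hquot _ (ker_ne_bot hi))
      (f := quotLift f.ker f fun x hx => LieHom.mem_ker.1 hx) fun y => by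
        obtain ⟨x, rfl⟩ := hf y
        exact ⟨quotMap _ x, rfl⟩)

theorem soc_eq_of_atom (hsol : soluble F L) (hL : IsPrimitive F L) {A : LieIdeal F L}
    (hA : IsAtom A) : soc F L = A := by
  refine le_antisymm (sSup_le fun B hB => ?_) (le_sSup hA)
  exact (hL.abelianIdeal_unique (.of_atom hsol hB) (.of_atom hsol hA) hB.1 hA.1).le

theorem StronglyContains.boundary_subset (hH : H.IsSchunck) (hK : K.IsSchunck)
    (h : H.StronglyContains K) : H.boundary ⊆ K.avoidance := by
  intro P _ _ hP
  have hprim := hH.isPrimitive_of_boundary hP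
  have hsol := hP.1
  refine ⟨⟨hsol, hprim⟩, fun V hV => ?_⟩
  rw [hK.isProjector_iff] at hV
  obtain ⟨M, hM, hcore⟩ := id hprim
  have hne : (⊤ : LieIdeal F P) ≠ ⊥ := by
    intro h0
    refine hM.1 (eq_top_iff.2 fun x _ => ?_)
    have : x ∈ (⊥ : LieIdeal F P) := h0 ▸ LieSubmodule.mem_top x
    rw [LieSubmodule.mem_bot] at this
    rw [this]
    exact M.zero_mem
  obtain ⟨A, hA, -⟩ := exists_atom_le hsol hne
  have hAab := IsAbelianIdeal.of_atom hsol hA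
  have htop := addIdeal_eq_top_of_isCoatom hM fun h => hA.1 (hcore A h)
  have hdisj := inf_eq_zero_of_core_free hM hcore hAab hA.1
  have hq := quotMap_surjective A
  let j : M →ₗ⁅F⁆ P ⧸ A := (quotMap A).comp M.incl
  have hj : Function.Bijective j := by
    constructor
    · rw [injective_iff_map_eq_zero]
      intro x hx
      exact Subtype.ext (hdisj x x.2 (quotMap_eq_zero.1 hx))
    · intro y
      obtain ⟨x, rfl⟩ := hq y
      obtain ⟨m, hm, a, ha, rfl⟩ := mem_addIdeal.1 (htop ▸ LieSubalgebra.mem_top x)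
      refine ⟨⟨m, hm⟩, ?_⟩
      rw [map_add, quotMap_eq_zero.2 ha, add_zero]
      rfl
  have hHM : H M :=
    hH.of_surjective (hP.2.2 A hA.1) (LieEquiv.ofBijective j hj).symm.surjective
      (f := (LieEquiv.ofBijective j hj).symm.toLieHom)
  have hMproj := hH.isHomProjector_of_boundary hP hM hcore hHM
  have hUj : ((V.map (quotMap A)).comap j).map j = V.map (quotMap A) :=
    map_comap_of_le_range fun y _ => hj.2 y
  -- The image of V in P/A is read back in the complement M through M ≅ P/A.
  have hU := IsHomProjector.of_bijective_map hj (hUj.symm ▸ hV.map hq)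
  have hU' := hK.isProjector_iff.1
    (h P hsol M (hH.isProjector_iff.2 hMproj) _ (hK.isProjector_iff.2 hU))
  generalize hU₁ : ((V.map (quotMap A)).comap j).map M.incl = U at hU'
  have hUM : U ≤ M := by
    intro x hx
    rw [← hU₁] at hx
    obtain ⟨y, -, rfl⟩ := (LieSubalgebra.mem_map ..).1 hx
    exact y.2
  have hUV : addIdeal U A = addIdeal V A := by
    have : U.map (quotMap A) = V.map (quotMap A) := by
      rw [← hU₁, map_map]
      exact hUj
    rw [addIdeal, this]; rfl
  let W := addIdeal V A
  have hVW : V ≤ W := le_addIdeal V A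
  have hUW : U ≤ W := (le_addIdeal U A).trans hUV.le
  obtain ⟨a, ha, hconj⟩ := IsHomProjector.conjugate hK (soluble_subalgebra hsol W)
    (hAab.comap (f := W.incl) Subtype.val_injective) (hU'.comap_incl hK hsol hUW)
    (hV.comap_incl hK hsol hVW) (addIdeal_comap_incl_eq_top hUW hUV.ge)
    (addIdeal_comap_incl_eq_top hVW le_rfl)
  rw [soc_eq_of_atom hsol hprim hA, eq_bot_iff]
  rintro x ⟨hxV, hxA⟩
  -- Since x = u + [a, u] with x and [a, u] in A, also u lies in A ∩ M = 0.
  obtain ⟨u, hu, hux⟩ := (hconj ⟨x, hVW hxV⟩).1 hxV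
  have hux' : (u : P) + ⁅(a : P), (u : P)⁆ = x := congrArg Subtype.val hux
  have hau : ⁅(a : P), (u : P)⁆ ∈ A := by
    rw [← lie_skew]
    exact A.neg_mem (A.lie_mem ha)
  have huA : (u : P) ∈ A := by
    have := A.sub_mem hxA hau
    rwa [← hux', add_sub_cancel_right] at this
  have hu0 := hdisj u (hUM hu) huA
  rw [hu0, lie_zero, add_zero] at hux'
  rw [LieSubalgebra.mem_bot, hux']

/-- In a soluble algebra, every subalgebra in `X` lies in an `X`-maximal one. -/
theorem exists_isMaximalIn_ge (hL : soluble F L) {U : LieSubalgebra F L} (hU : X U) :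
    ∃ V : LieSubalgebra F L, U ≤ V ∧ X.IsMaximalIn V := by
  obtain ⟨hfin, -⟩ := hL
  have hwf := LieSubalgebra.wellFoundedGT_of_noetherian F L
  obtain ⟨V, ⟨hUV, hV⟩, hmax⟩ := hwf.wf.has_min {V : LieSubalgebra F L | U ≤ V ∧ X V}
    ⟨U, le_rfl, hU⟩
  refine ⟨V, hUV, hV, fun S hVS hS => ?_⟩
  by_contra hne
  exact hmax S ⟨hUV.trans hVS, hS⟩ (lt_of_le_of_ne hVS (Ne.symm hne))

/-- The H-projector is given as an injection so that the induction hypothesis applies unchanged when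
L is replaced by a smaller subalgebra containing the range. -/
theorem IsHomProjector.trans_of_boundary_subset_aux (hH : H.IsSchunck) (hK : K.IsSchunck)
    (h : H.boundary ⊆ K.avoidance) (n : ℕ) :
    ∀ (L : Type u) [LieRing L] [LieAlgebra F L], soluble F L → Module.finrank F L < n →
    ∀ (U : Type u) [LieRing U] [LieAlgebra F U] (i : U →ₗ⁅F⁆ L), Function.Injective i →
    H.IsHomProjector i.range → ∀ V : LieSubalgebra F U, K.IsHomProjector V →
    K.IsHomProjector (V.map i) := by
  induction n with
  | zero => intro L _ _ _ h; exact absurd h (Nat.not_lt_zero _)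
  | succ n ih =>
    intro L _ _ hL hn U _ _ i hi hU V hV
    have hquot : ∀ (Q : Type u) [LieRing Q] [LieAlgebra F Q] (f : L →ₗ⁅F⁆ Q),
        Function.Surjective f → ¬ Function.Injective f →
        K.IsHomProjector ((V.map i).map f) := by
      intro Q _ _ f hf hfi
      have hlt := finrank_lt_of_surjective hL hf hfi
      let k : U →ₗ⁅F⁆ i.range.map f := codRestrict (f.comp i) _
        fun x => mem_map_of_mem _ (i.mem_range_self x)
      have hk : Function.Surjective k := by
        rintro ⟨y, hy⟩
        obtain ⟨x, hx, rfl⟩ := (LieSubalgebra.mem_map ..).1 hy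
        obtain ⟨t, rfl⟩ := hx
        exact ⟨t, rfl⟩
      have := ih Q (soluble_of_surjective hL hf) (by omega) _ (i.range.map f).incl
        Subtype.val_injective (by rw [LieSubalgebra.incl_range]; exact hU.map hf) _ (hV.map hk)
      rw [map_map] at this ⊢
      exact this
    have hquotN : ∀ N : LieIdeal F L, IsAtom N →
        K.IsHomProjector ((V.map i).map (quotMap N)) := fun N hN =>
      hquot _ _ (quotMap_surjective N) (quotMap_not_injective hN.1)
    have hle : ∀ N : LieIdeal F L, IsAtom N → ∀ S : LieSubalgebra F L, V.map i ≤ S → K S →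
        S ≤ addIdeal (V.map i) N := fun N hN S hVS hS =>
      le_addIdeal_of_map_le
        ((hquotN N hN).isMaximalIn.2 _ (map_mono _ hVS) (hK.map hS _)).le
    have hVi : V.map i ≤ i.range := by
      intro x hx
      obtain ⟨y, -, rfl⟩ := (LieSubalgebra.mem_map ..).1 hx
      exact i.mem_range_self y
    have hmax : K.IsMaximalIn (V.map i) := by
      by_cases htop : i.range = ⊤
      · exact hV.isMaximalIn.map hK ⟨hi, fun y =>
          LieHom.mem_range i y |>.1 (htop ▸ LieSubalgebra.mem_top y)⟩
      refine ⟨hK.map hV.isMaximalIn.1 i, fun S hVS hS => ?_⟩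
      by_cases hex : ∃ N : LieIdeal F L, IsAtom N ∧ addIdeal i.range N ≠ ⊤
      · obtain ⟨N, hN, hW⟩ := hex
        let W := addIdeal i.range N
        have hiW : i.range ≤ W := le_addIdeal _ _
        let i' : U →ₗ⁅F⁆ W := codRestrict i W fun x => hiW (i.mem_range_self x)
        have hi' : Function.Injective i' := fun x y hxy => hi (congrArg Subtype.val hxy)
        have hrange : i'.range = i.range.comap W.incl := by
          ext x
          rw [LieHom.mem_range, LieSubalgebra.mem_comap, LieHom.mem_range]
          exact ⟨fun ⟨y, hy⟩ => ⟨y, congrArg Subtype.val hy⟩,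
            fun ⟨y, hy⟩ => ⟨y, Subtype.ext hy⟩⟩
        have hlt : Module.finrank F W < Module.finrank F L := finrank_lt_of_ne_top hL hW
        have hproj := ih W (soluble_subalgebra hL W) (by omega) U i' hi'
          (hrange ▸ hU.comap_incl hH hL hiW) V hV
        have hmap : (V.map i').map W.incl = V.map i := by
          rw [map_map, incl_codRestrict]
        rw [← hmap]
        refine hproj.isMaximalIn.eq_of_le_range hK Subtype.val_injective (fun y hy => ?_)
          (hmap.trans_le hVS) hS
        obtain ⟨u, hu, a, ha, hy'⟩ := mem_addIdeal.1 (hle N hN S hVS hS hy)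
        exact ⟨⟨y, mem_addIdeal.2 ⟨u, hVi hu, a, ha, hy'⟩⟩, rfl⟩
      push Not at hex
      -- Now U supplements every minimal ideal, so it maps onto every proper quotient of L and puts
      -- it in H.
      have hbdry : H.boundary L := by
        refine ⟨hL, fun hHL => htop (hU.isMaximalIn.eq_top hH hHL), fun J hJ => ?_⟩
        obtain ⟨N, hN, hNJ⟩ := exists_atom_le hL hJ
        have h1 := map_eq_top_of_addIdeal_eq_top (quotMap_surjective J)
          (fun x hx => quotMap_eq_zero.2 (hNJ hx)) (hex N hN)
        have h2 := hH.map hU.isMaximalIn.1 (quotMap J)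
        rw [h1] at h2
        exact hH.top_iff.1 h2
      have hne : (⊤ : LieIdeal F L) ≠ ⊥ := by
        intro h0
        refine htop (eq_top_iff.2 fun x _ => ?_)
        have : x ∈ (⊥ : LieIdeal F L) := h0 ▸ LieSubmodule.mem_top x
        rw [LieSubmodule.mem_bot] at this
        rw [this]
        exact i.range.zero_mem
      obtain ⟨N, hN, -⟩ := exists_atom_le hL hne
      obtain ⟨R, hSR, hR⟩ := exists_isMaximalIn_ge hL hS
      have hVR := hVS.trans hSR
      have hRT := hle N hN R hVR hR.1
      let T := addIdeal (V.map i) N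
      have hRproj : K.IsHomProjector (R.comap T.incl) := by
        refine IsMaximalIn.isHomProjector hK (soluble_subalgebra hL T)
          ((IsAbelianIdeal.of_atom hL hN).comap (f := T.incl) Subtype.val_injective)
          (IsMaximalIn.of_map hK (f := T.incl) Subtype.val_injective
            (by rw [map_incl_comap hRT]; exact hR))
          (addIdeal_comap_incl_eq_top hRT ?_)
        intro x hx
        obtain ⟨v, hv, a, ha, rfl⟩ := mem_addIdeal.1 hx
        exact mem_addIdeal.2 ⟨v, hVR hv, a, ha, rfl⟩
      -- The avoidance hypothesis speaks only of projectors, so S was enlarged to a K-maximal R. It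
      -- supplements N in T = V + N, hence is a projector of T, and T/N is a projector of L/N.
      have hRL := IsHomProjector.lift hK (i := T.incl) (N := N)
        (fun x hx => ⟨⟨x, mem_addIdeal_right _ hx⟩, rfl⟩)
        (by rw [LieSubalgebra.incl_range, map_quotMap_addIdeal]; exact hquotN N hN) hRproj
      rw [map_incl_comap hRT] at hRL
      have hinf := (h L hbdry).2 R (hK.isProjector_iff.2 hRL)
      refine le_antisymm (fun x hx => ?_) hVS
      obtain ⟨v, hv, a, ha, rfl⟩ := mem_addIdeal.1 (hRT (hSR hx))
      have haR : a ∈ R := by simpa using R.sub_mem (hSR hx) (hVR hv)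
      have ha0 : a ∈ R ⊓ LieIdeal.toLieSubalgebra F L (soc F L) :=
        ⟨haR, (le_sSup hN : N ≤ soc F L) ha⟩
      rw [hinf, LieSubalgebra.mem_bot] at ha0
      rwa [ha0, add_zero]
    intro Q _ _ f hf
    by_cases hfi : Function.Injective f
    · exact hmax.map hK ⟨hfi, hf⟩
    · exact (hquot Q f hf hfi).isMaximalIn

theorem stronglyContains_of_boundary_subset (hH : H.IsSchunck) (hK : K.IsSchunck)
    (h : H.boundary ⊆ K.avoidance) : H.StronglyContains K := by
  intro L _ _ hL U hU V hV
  rw [hK.isProjector_iff] at hV ⊢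
  rw [hH.isProjector_iff] at hU
  exact IsHomProjector.trans_of_boundary_subset_aux hH hK h _ L hL (Nat.lt_succ_self _) U U.incl
    Subtype.val_injective (by rwa [LieSubalgebra.incl_range]) V hV

end LieClass

/-- Strong containment of Schunck classes is characterized by boundary and avoidance class. Either
side of the equivalence already forces `K ⊆ H`, so that the proof does not need this hypothesis. -/
theorem mainTheorem4 {F : Type u} [Field F] (H K : LieClass F)
    (hH : H.IsSchunck) (hK : K.IsSchunck) (hKH : K ⊆ H) :
    H.StronglyContains K ↔ H.boundary ⊆ K.avoidance :=
  ⟨LieClass.StronglyContains.boundary_subset hH hK,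
    LieClass.stronglyContains_of_boundary_subset hH hK⟩
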